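/- Let $G$ be the simply connected simple algebraic group over $\mathbb C$ of type $B_n$, with Chevalley generators $e_i,f_i$ and simple coroots $h_i=[e_i,f_i]$ of its Lie algebra ($i=1,\dots,n$; Cartan integers $a_{ij}=\alpha_j(h_i)$, $\alpha_n$ the short simple root, so $a_{n,n-1}=-2$), maximal torus $T$, opposite maximal unipotent subgroups $U^{\pm}$, fundamental weights $\Lambda_i$, and Weyl group $W$ generated by the simple reflections $s_i$, with longest element $w_0$. Put $x_i(t)=\exp(te_i)$, $y_i(t)=\exp(tf_i)$, and let $\alpha_i^\vee(c)=\phi_i(\mathrm{diag}(c,c^{-1}))$, where $\phi_i:SL_2(\mathbb C)\to G$ is the homomorphism sending $\begin{pmatrix}1&t\\0&1\end{pmatrix}$ to $x_i(t)$ and $\begin{pmatrix}1&0\\t&1\end{pmatrix}$ to $y_i(t)$. Put $\mathbf y_i(c)=y_i(c)\,\alpha_i^\vee(c^{-1})$ and $\overline{s}_i=x_i(-1)y_i(1)x_i(-1)$, and for $w\in W$ put $\overline w=\overline{s}_{i_1}\cdots\overline{s}_{i_l}$, where $s_{i_1}\cdots s_{i_l}$ is any reduced expression of $w$. For a dominant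 weight $\mu$ let $\Delta_\mu$ be the regular function on $G$ with $\Delta_\mu(u^-tu^+)=\mu(t)$ for $u^\pm\in U^\pm$, $t\in T$; for $u,v\in W$ the generalized minor is $\Delta_{u\mu,v\mu}(g)=\Delta_\mu(\overline u^{\,-1}g\,\overline v)$. For $c=(c^{(p)}_i)_{1\le p,i\le n}\in(\mathbb C^\times)^{n^2}$ let $$\Theta^-_{\mathbf i_0}(c)=\prod_{p=1}^{n}\bigl(\mathbf y_1(c^{(p)}_1)\,\mathbf y_2(c^{(p)}_2)\cdots\mathbf y_n(c^{(p)}_n)\bigr),$$ the factors being taken in the order $p=1,2,\dots,n$ from left to right; this corresponds to the reduced word $\mathbf i_0=(1\,2\cdots n)^n$ of $w_0$. **Theorem.** For every $k\in\{1,\dots,n-1\}$ and every $c\in(\mathbb C^\times)^{n^2}$, $$\Delta_{w_0s_k\Lambda_k,\,\Lambda_k}\bigl(\Theta^-_{\mathbf i_0}(c)\bigr)=\frac1{c^{(k)}_1}+\sum_{j=1}^{k-1}\frac{c^{(j)}_{k-j}}{c^{(j)}_{k-j+1}}.$$ -/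

import Mathlib

namespace TypeB

/-! Type `B_n` over `ℂ`.  The index set `I = {1, …, n}` is `Fin n`, so `i : Fin n` stands for the
index `i + 1`; the last node (`i + 1 = n`) is the short simple root. -/

/-- The Cartan matrix `a i j = ⟨h_i, α_j⟩` of type `B_n`. -/
def cartan (n : ℕ) (i j : Fin n) : ℤ :=
  if i = j then 2
  else if i.val + 1 = n ∧ j.val + 1 = i.val then -2
  else if j.val + 1 = i.val ∨ i.val + 1 = j.val then -1
  else 0

section Weyl

/-- The weight lattice `P`; the weight `λ` has coordinates `λ i = ⟨h_i, λ⟩`, so that the standard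
basis consists of the fundamental weights. -/
abbrev Weight (n : ℕ) := Fin n → ℤ

variable {n : ℕ}

/-- The fundamental weight `Λ_k`. -/
def fundWeight (k : Fin n) : Weight n := Pi.single k 1

/-- The simple root `α_j`. -/
def simpleRoot (j : Fin n) : Weight n := fun i => cartan n i j

theorem proj_simpleRoot (i : Fin n) :
    (LinearMap.proj i : Weight n →ₗ[ℤ] ℤ) (simpleRoot i) = 2 := by
  simp [simpleRoot, cartan]

/-- The simple reflection `s_i λ = λ - ⟨h_i, λ⟩ α_i`. -/
def simpleReflection (i : Fin n) : Weight n ≃ₗ[ℤ] Weight n :=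
  Module.reflection (proj_simpleRoot i)

variable (n) in
/-- The Weyl group, acting (faithfully) on the weight lattice. -/
def weylGroup : Subgroup (Weight n ≃ₗ[ℤ] Weight n) :=
  Subgroup.closure (Set.range simpleReflection)

/-- The simple reflection as an element of the Weyl group. -/
def simple (i : Fin n) : weylGroup n :=
  ⟨simpleReflection i, Subgroup.subset_closure ⟨i, rfl⟩⟩

/-- The Weyl group element `s_{i_1} ⋯ s_{i_l}` of a word. -/
def wordProd (ω : List (Fin n)) : weylGroup n := (ω.map simple).prod

theorem simple_mul_self (i : Fin n) : simple i * simple i = 1 := by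
  apply Subtype.ext
  apply LinearEquiv.ext
  intro x
  exact Module.involutive_reflection (proj_simpleRoot i) x

theorem exists_wordProd (w : weylGroup n) : ∃ ω : List (Fin n), wordProd ω = w := by
  obtain ⟨w, hw⟩ := w
  induction hw using Subgroup.closure_induction with
  | mem x hx =>
    obtain ⟨i, rfl⟩ := hx
    exact ⟨[i], by simp [wordProd, simple]⟩
  | one => exact ⟨[], rfl⟩
  | mul x y hx hy ihx ihy =>
    obtain ⟨a, ha⟩ := ihx
    obtain ⟨b, hb⟩ := ihy
    refine ⟨a ++ b, ?_⟩
    have h : wordProd (a ++ b) = wordProd a * wordProd b := by simp [wordProd]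
    rw [h, ha, hb]
    rfl
  | inv x hx ih =>
    obtain ⟨a, ha⟩ := ih
    refine ⟨a.reverse, ?_⟩
    have h : ∀ a : List (Fin n), wordProd a.reverse * wordProd a = 1 := by
      intro a
      induction a with
      | nil => simp [wordProd]
      | cons i t iht =>
        have h1 : wordProd (i :: t).reverse = wordProd t.reverse * simple i := by
          simp [wordProd]
        have h2 : wordProd (i :: t) = simple i * wordProd t := by simp [wordProd]
        rw [h1, h2, mul_assoc, ← mul_assoc (simple i), simple_mul_self, one_mul, iht]
    have h3 := eq_inv_of_mul_eq_one_left (h a)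
    rw [h3, ha]
    rfl

/-- The length of a Weyl group element: the least length of a word for it. -/
noncomputable def length (w : weylGroup n) : ℕ :=
  sInf {l | ∃ ω : List (Fin n), wordProd ω = w ∧ ω.length = l}

theorem exists_reduced (w : weylGroup n) :
    ∃ ω : List (Fin n), wordProd ω = w ∧ ω.length = length w := by
  obtain ⟨ω, hω⟩ := exists_wordProd w
  exact Nat.sInf_mem (s := {l | ∃ ω : List (Fin n), wordProd ω = w ∧ ω.length = l})
    ⟨ω.length, ω, hω, rfl⟩

/-- A reduced word of a Weyl group element. -/
noncomputable def reducedWord (w : weylGroup n) : List (Fin n) := (exists_reduced w).choose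

/-- `w` is the longest element of the Weyl group. -/
def IsLongest (w : weylGroup n) : Prop := ∀ w' : weylGroup n, length w' ≤ length w

end Weyl

section Representation

attribute [local instance] LieRing.ofAssociativeRing

variable {n : ℕ}

/-- Index set of the basis of the vector representation `V(Λ_1)`: `inl j` is `v_j`,
`inr (inl ())` is `v_0`, `inr (inr j)` is `v_{j̄}`. -/
abbrev VecIdx (n : ℕ) := Fin n ⊕ Unit ⊕ Fin n

/-- Index set of the basis of the spin representation `V(Λ_n)`: the sign vectors
`(ε_1, …, ε_n)`, with `true` for `+`. -/
abbrev SpinIdx (n : ℕ) := Fin n → Bool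

/-- Index set of the basis of `V(Λ_1) ⊕ V(Λ_n)`. -/
abbrev Idx (n : ℕ) := VecIdx n ⊕ SpinIdx n

/-- `f_i` on the vector representation (column `b` holds `f_i v_b`):
`f_i v_i = v_{i+1}`, `f_i v_{\overline{i+1}} = v_{\bar i}` for `i < n`, and
`f_n v_n = v_0`, `f_n v_0 = 2 v_{\bar n}`. -/
def vecF (i : Fin n) : Matrix (VecIdx n) (VecIdx n) ℂ :=
  Matrix.of fun a b =>
    match b, a with
    | .inl j, .inl k => if j = i ∧ k.val = i.val + 1 then 1 else 0
    | .inr (.inr j), .inr (.inr k) => if j.val = i.val + 1 ∧ k = i then 1 else 0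
    | .inl j, .inr (.inl _) => if i.val + 1 = n ∧ j = i then 1 else 0
    | .inr (.inl _), .inr (.inr k) => if i.val + 1 = n ∧ k = i then 2 else 0
    | _, _ => 0

/-- `e_i` on the vector representation:
`e_i v_{i+1} = v_i`, `e_i v_{\bar i} = v_{\overline{i+1}}` for `i < n`, and
`e_n v_0 = 2 v_n`, `e_n v_{\bar n} = v_0`. -/
def vecE (i : Fin n) : Matrix (VecIdx n) (VecIdx n) ℂ :=
  Matrix.of fun a b =>
    match b, a with
    | .inl j, .inl k => if j.val = i.val + 1 ∧ k = i then 1 else 0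
    | .inr (.inr j), .inr (.inr k) => if j = i ∧ k.val = i.val + 1 then 1 else 0
    | .inr (.inl _), .inl k => if i.val + 1 = n ∧ k = i then 2 else 0
    | .inr (.inr j), .inr (.inl _) => if i.val + 1 = n ∧ j = i then 1 else 0
    | _, _ => 0

/-- `f_i` on the spin representation: it turns `(+,-)` in positions `i, i+1` into `(-,+)` for
`i < n`, and `+` in position `n` into `-` for `i = n`; all other basis vectors are killed. -/
def spinF (i : Fin n) : Matrix (SpinIdx n) (SpinIdx n) ℂ :=
  Matrix.of fun a b =>
    if h : i.val + 1 < n then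
      if b i = true ∧ b ⟨i.val + 1, h⟩ = false ∧
          a = Function.update (Function.update b i false) ⟨i.val + 1, h⟩ true then 1 else 0
    else
      if b i = true ∧ a = Function.update b i false then 1 else 0

/-- `e_i` on the spin representation: it turns `(-,+)` in positions `i, i+1` into `(+,-)` for
`i < n`, and `-` in position `n` into `+` for `i = n`; all other basis vectors are killed. -/
def spinE (i : Fin n) : Matrix (SpinIdx n) (SpinIdx n) ℂ :=
  Matrix.of fun a b =>
    if h : i.val + 1 < n then
      if b i = false ∧ b ⟨i.val + 1, h⟩ = true ∧
          a = Function.update (Function.update b i true) ⟨i.val + 1, h⟩ false then 1 else 0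
    else
      if b i = false ∧ a = Function.update b i true then 1 else 0

/-- The Chevalley generator `e_i` acting on `V(Λ_1) ⊕ V(Λ_n)`. -/
def genE (i : Fin n) : Matrix (Idx n) (Idx n) ℂ := Matrix.fromBlocks (vecE i) 0 0 (spinE i)

/-- The Chevalley generator `f_i` acting on `V(Λ_1) ⊕ V(Λ_n)`. -/
def genF (i : Fin n) : Matrix (Idx n) (Idx n) ℂ := Matrix.fromBlocks (vecF i) 0 0 (spinF i)

/-- The simple coroot `h_i = [e_i, f_i]`. -/
def genH (i : Fin n) : Matrix (Idx n) (Idx n) ℂ := ⁅genE i, genF i⁆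

variable (n) in
/-- The simple Lie algebra `𝔤` of type `B_n`, generated by the `e_i`, `f_i` in the faithful
representation `V(Λ_1) ⊕ V(Λ_n)`. -/
def lieAlg : LieSubalgebra ℂ (Matrix (Idx n) (Idx n) ℂ) :=
  LieSubalgebra.lieSpan ℂ (Matrix (Idx n) (Idx n) ℂ) (Set.range genE ∪ Set.range genF)

/-- The weight space `𝔤_α` (a root space if `α` is a root). -/
def rootSpace (α : Weight n) : Set (Matrix (Idx n) (Idx n) ℂ) :=
  {x | x ∈ lieAlg n ∧ ∀ i, ⁅genH i, x⁆ = (α i : ℂ) • x}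

/-- `α` is a nonzero combination of simple roots with nonnegative integer coefficients. -/
def IsPositive (α : Weight n) : Prop :=
  α ≠ 0 ∧ ∃ m : Fin n → ℕ, α = ∑ j, (m j : ℤ) • simpleRoot j

end Representation

section Group

variable {n : ℕ}

/-- The ambient group `GL(V(Λ_1) ⊕ V(Λ_n))`. -/
abbrev Ambient (n : ℕ) := (Matrix (Idx n) (Idx n) ℂ)ˣ

/-- The exponential of a matrix, as an invertible matrix. -/
noncomputable def expUnit (x : Matrix (Idx n) (Idx n) ℂ) : Ambient n := (Matrix.isUnit_exp x).unit

variable (n) in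
/-- The simply connected simple algebraic group `G` (that is, `Spin_{2n+1}(ℂ)`) of type `B_n`, as
the Chevalley group generated by all `exp (t e_i)`, `exp (t f_i)` in the representation
`V(Λ_1) ⊕ V(Λ_n)`, whose weights generate the whole weight lattice `P`. -/
noncomputable def grp : Subgroup (Ambient n) :=
  Subgroup.closure {g | ∃ (i : Fin n) (t : ℂ), g = expUnit (t • genE i) ∨ g = expUnit (t • genF i)}

/-- `x_i(t) = exp (t e_i)`. -/
noncomputable def x (i : Fin n) (t : ℂ) : grp n :=
  ⟨expUnit (t • genE i), Subgroup.subset_closure ⟨i, t, Or.inl rfl⟩⟩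

/-- `y_i(t) = exp (t f_i)`. -/
noncomputable def y (i : Fin n) (t : ℂ) : grp n :=
  ⟨expUnit (t • genF i), Subgroup.subset_closure ⟨i, t, Or.inr rfl⟩⟩

/-- `α_i^∨(c) = φ_i(diag(c, c⁻¹))`, where `φ_i : SL₂ → G` sends the elementary upper and lower
unitriangular matrices with entry `t` to `x_i(t)` and `y_i(t)`.  In `SL₂`, with
`x t = !![1, t; 0, 1]` and `y t = !![1, 0; t, 1]`,
`diag(c, c⁻¹) = x c * y (-c⁻¹) * x c * x (-1) * y 1 * x (-1)`. -/
noncomputable def coroot (i : Fin n) (c : ℂˣ) : grp n :=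
  x i (c : ℂ) * y i (-(c : ℂ)⁻¹) * x i (c : ℂ) * x i (-1) * y i 1 * x i (-1)

/-- The element `∏ α_i^∨(c_i)` of the maximal torus `T`; as `G` is simply connected, every element
of `T` has exactly one such expression. -/
noncomputable def torus (c : Fin n → ℂˣ) : grp n := (List.ofFn fun i => coroot i (c i)).prod

variable (n) in
/-- `U = U⁺`, generated by the root subgroups `exp 𝔤_α` for positive `α`. -/
noncomputable def unipPos : Subgroup (Ambient n) :=
  Subgroup.closure {g | ∃ α, IsPositive α ∧ ∃ z ∈ rootSpace α, g = expUnit z}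

variable (n) in
/-- `U⁻`, generated by the root subgroups `exp 𝔤_{-α}` for positive `α`. -/
noncomputable def unipNeg : Subgroup (Ambient n) :=
  Subgroup.closure {g | ∃ α, IsPositive α ∧ ∃ z ∈ rootSpace (-α), g = expUnit z}

/-- Regular functions on `G`: polynomials in the matrix entries (the determinant is `1` on `G`). -/
def IsRegular (f : grp n → ℂ) : Prop :=
  ∃ p : MvPolynomial (Idx n × Idx n) ℂ,
    ∀ g : grp n, f g = MvPolynomial.eval (fun ab => (g : Ambient n).val ab.1 ab.2) p

/-- `D` is the principal minor `Δ_μ`: the regular function on `G` with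
`Δ_μ (u⁻ t u⁺) = μ(t)` for `u^± ∈ U^±`, `t ∈ T`.  Here `μ(∏ α_i^∨(c_i)) = ∏ c_i ^ ⟨h_i, μ⟩`. -/
def IsPrincipalMinor (μ : Weight n) (D : grp n → ℂ) : Prop :=
  IsRegular D ∧
    ∀ (g : grp n) (c : Fin n → ℂˣ), ∀ u ∈ unipNeg n, ∀ v ∈ unipPos n,
      (g : Ambient n) = u * (torus c : Ambient n) * v → D g = ∏ i, (c i : ℂ) ^ μ i

open Classical in
/-- The principal minor `Δ_μ` (for dominant `μ`). -/
noncomputable def principalMinor (μ : Weight n) : grp n → ℂ :=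
  if h : ∃ D, IsPrincipalMinor μ D then h.choose else 0

/-- `\bar s_i = x_i(-1) y_i(1) x_i(-1)`. -/
noncomputable def sBar (i : Fin n) : grp n := x i (-1) * y i 1 * x i (-1)

/-- The representative `\bar w = \bar s_{i_1} ⋯ \bar s_{i_l}` of `w`, for a reduced word
`i_1 ⋯ i_l` of `w`. -/
noncomputable def lift (w : weylGroup n) : grp n := ((reducedWord w).map sBar).prod

open Classical in
/-- The generalized minor `Δ_{γ,δ}(g) = Δ_μ(\bar u⁻¹ g \bar v)`, where `γ = u μ`, `δ = v μ` with
`u, v` in the Weyl group. -/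
noncomputable def genMinor (μ γ δ : Weight n) (g : grp n) : ℂ :=
  if h : (∃ u : weylGroup n, u.1 μ = γ) ∧ ∃ v : weylGroup n, v.1 μ = δ then
    principalMinor μ ((lift h.1.choose)⁻¹ * g * lift h.2.choose)
  else 0

/-- `𝐲_i(c) = y_i(c) α_i^∨(c⁻¹)`. -/
noncomputable def yBold (i : Fin n) (c : ℂˣ) : grp n := y i (c : ℂ) * coroot i c⁻¹

/-- `Θ⁻_{𝐢₀}(c)` for `𝐢₀ = (1 2 ⋯ n)^n`: the product over `p = 1, …, n` (in this order) of
`𝐲_1(c^{(p)}_1) 𝐲_2(c^{(p)}_2) ⋯ 𝐲_n(c^{(p)}_n)`.  The variable `c^{(p)}_i` is `c p i`, with both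
indices shifted to start from `0`. -/
noncomputable def theta (c : Fin n → Fin n → ℂˣ) : grp n :=
  (List.ofFn fun p => (List.ofFn fun i => yBold i (c p i)).prod).prod

end Group

end TypeB

/-!
For `k + 1 < n` the principal minor of `Λ_k` is the leading minor of size `k + 1` in the vector
representation, because it multiplies by `1` under `U^±` and by `Λ_k` under the torus. In that
representation each `SL₂` acts by a sum of trivial, tautological and, for the short root, symmetric
square representations, so `\bar s_i` is an explicit signed permutation matrix. Along a reduced word
its signs do not matter: they contribute `+1` to every minor whose rows, or columns, are sorted by
height. The generalized minor is therefore an honest minor of `Θ⁻_{𝐢₀}(c)`, with columns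
`v_1, …, v_{k+1}` and, as `w_0 = -1`, rows `v_{j̄}` for `j = k + 2, k, …, 1`.

The entries of the minor obey a two-term recursion in the number of factors of `Θ⁻_{𝐢₀}(c)`. Adding
multiples of each row to the next one strips off one factor and clears the first column; expanding
along it lowers the size by one. The minor with consecutive rows is `1` at every stage, and the
one with a gap below its first row picks up one quotient `c^{(j)}_{k-j} / c^{(j)}_{k-j+1}` per
stage.
-/

namespace TypeB

open scoped Matrix

variable {n : ℕ}

section Exponential

variable {α β : Type*} [Fintype α] [DecidableEq α] [Fintype β] [DecidableEq β]

theorem hasSum_matrix_exp (z : Matrix α α ℂ) :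
    HasSum (fun m : ℕ => ((m.factorial : ℂ)⁻¹) • z ^ m) (NormedSpace.exp z) := by
  let _ : SeminormedRing (Matrix α α ℂ) := Matrix.linftyOpSemiNormedRing
  let _ : NormedRing (Matrix α α ℂ) := Matrix.linftyOpNormedRing
  let _ : NormedAlgebra ℂ (Matrix α α ℂ) := Matrix.linftyOpNormedAlgebra
  exact NormedSpace.exp_series_hasSum_exp' (𝕂 := ℂ) z

theorem exp_smul_of_pow_three_eq_zero {e : Matrix α α ℂ} (he : e ^ 3 = 0) (t : ℂ) :
    NormedSpace.exp (t • e) = 1 + t • e + (t ^ 2 / 2) • e ^ 2 := by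
  have hvanish : ∀ m ∉ Finset.range 3, ((m.factorial : ℂ)⁻¹) • (t • e) ^ m = 0 := by
    intro m hm
    rw [smul_pow, pow_eq_zero_of_le (by simpa using hm) he, smul_zero, smul_zero]
  refine (hasSum_matrix_exp (t • e)).unique ?_
  convert hasSum_sum_of_ne_finset_zero hvanish using 1
  · simp [Finset.sum_range_succ, smul_pow, smul_smul, div_eq_inv_mul]
  · infer_instance

theorem exp_fromBlocks_zero (A : Matrix α α ℂ) (D : Matrix β β ℂ) :
    NormedSpace.exp (Matrix.fromBlocks A 0 0 D) =
      Matrix.fromBlocks (NormedSpace.exp A) 0 0 (NormedSpace.exp D) := by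
  have hpow (m : ℕ) :
      Matrix.fromBlocks A 0 0 D ^ m = Matrix.fromBlocks (A ^ m) 0 0 (D ^ m) := by
    induction m with
    | zero => simp
    | succ m ih => simp [pow_succ, ih, Matrix.fromBlocks_multiply]
  refine (hasSum_matrix_exp _).unique (Pi.hasSum.2 fun a => Pi.hasSum.2 fun b => ?_)
  have hA := hasSum_matrix_exp A
  have hD := hasSum_matrix_exp D
  simp only [hpow, Matrix.fromBlocks_smul, smul_zero]
  rcases a with a | a <;> rcases b with b | b
  · exact Pi.hasSum.1 (Pi.hasSum.1 hA a) b
  · exact hasSum_zero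
  · exact hasSum_zero
  · exact Pi.hasSum.1 (Pi.hasSum.1 hD a) b

end Exponential

/-- `φ` is the representation of the monoid of `2 × 2` matrices whose restriction to `SL₂`
integrates the `𝔰𝔩₂`-triple `e`, `f`, `[e, f]` on a space with a basis of weight vectors, the
basis vector `b` having weight `d b`. -/
structure Integrates {α : Type*} [Fintype α] [DecidableEq α]
    (φ : Matrix (Fin 2) (Fin 2) ℂ →* Matrix α α ℂ) (e f : Matrix α α ℂ) (d : α → ℤ) : Prop where
  exp_raise (t : ℂ) : NormedSpace.exp (t • e) = φ !![1, t; 0, 1]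
  exp_lower (t : ℂ) : NormedSpace.exp (t • f) = φ !![1, 0; t, 1]
  map_diagonal (c : ℂˣ) :
    φ !![(c : ℂ), 0; 0, (c : ℂ)⁻¹] = Matrix.diagonal fun b => (c : ℂ) ^ d b
  lie_eq : e * f - f * e = Matrix.diagonal fun b => (d b : ℂ)

section Blocks

variable {α β : Type*} [Fintype α] [DecidableEq α] [Fintype β] [DecidableEq β]

/-- The direct sum of two representations of a monoid by matrices. -/
def blockSum {M : Type*} [Monoid M] (φ : M →* Matrix α α ℂ) (ψ : M →* Matrix β β ℂ) :
    M →* Matrix (α ⊕ β) (α ⊕ β) ℂ where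
  toFun A := Matrix.fromBlocks (φ A) 0 0 (ψ A)
  map_one' := by simp
  map_mul' A B := by simp [Matrix.fromBlocks_multiply]

theorem blockSum_apply {M : Type*} [Monoid M] (φ : M →* Matrix α α ℂ) (ψ : M →* Matrix β β ℂ)
    (A : M) : blockSum φ ψ A = Matrix.fromBlocks (φ A) 0 0 (ψ A) := rfl

theorem Integrates.blockSum {φ : Matrix (Fin 2) (Fin 2) ℂ →* Matrix α α ℂ}
    {ψ : Matrix (Fin 2) (Fin 2) ℂ →* Matrix β β ℂ} {e f : Matrix α α ℂ} {e' f' : Matrix β β ℂ}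
    {d : α → ℤ} {d' : β → ℤ} (hφ : Integrates φ e f d) (hψ : Integrates ψ e' f' d') :
    Integrates (blockSum φ ψ) (Matrix.fromBlocks e 0 0 e') (Matrix.fromBlocks f 0 0 f')
      (Sum.elim d d') where
  exp_raise t := by
    rw [Matrix.fromBlocks_smul, smul_zero, smul_zero, exp_fromBlocks_zero, hφ.exp_raise,
      hψ.exp_raise, blockSum_apply]
  exp_lower t := by
    rw [Matrix.fromBlocks_smul, smul_zero, smul_zero, exp_fromBlocks_zero, hφ.exp_lower,
      hψ.exp_lower, blockSum_apply]
  map_diagonal c := by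
    rw [blockSum_apply, hφ.map_diagonal, hψ.map_diagonal, Matrix.fromBlocks_diagonal]
    congr 1
    ext (b | b) <;> rfl
  lie_eq := by
    simp only [Matrix.fromBlocks_multiply, sub_eq_add_neg, Matrix.fromBlocks_neg,
      Matrix.fromBlocks_add, Matrix.mul_zero, Matrix.zero_mul, add_zero, zero_add, neg_zero]
    rw [← sub_eq_add_neg, ← sub_eq_add_neg, hφ.lie_eq, hψ.lie_eq, Matrix.fromBlocks_diagonal]
    congr 1
    ext (b | b) <;> rfl

end Blocks

section Minuscule

variable {α : Type*} [Fintype α] [DecidableEq α] {σ : α → α} {d : α → ℤ}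

/-- The matrix sending the basis vector `b` of weight `-1` to the basis vector `σ b`, and all other
basis vectors to zero. -/
def raise (σ : α → α) (d : α → ℤ) : Matrix α α ℂ :=
  Matrix.of fun a b => if d b = -1 ∧ a = σ b then 1 else 0

/-- The matrix sending the basis vector `b` of weight `1` to the basis vector `σ b`, and all other
basis vectors to zero. -/
def lower (σ : α → α) (d : α → ℤ) : Matrix α α ℂ :=
  Matrix.of fun a b => if d b = 1 ∧ a = σ b then 1 else 0

/-- The matrix of a `2 × 2` matrix `A` acting as the tautological representation on each pair
`b`, `σ b` of basis vectors of weights `1`, `-1`, and trivially on all other basis vectors. -/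
def minusculeMatrix (σ : α → α) (d : α → ℤ) (A : Matrix (Fin 2) (Fin 2) ℂ) : Matrix α α ℂ :=
  Matrix.of fun a b =>
    if d b = 1 then (1 : Matrix α α ℂ) a b * A 0 0 + (1 : Matrix α α ℂ) a (σ b) * A 1 0
    else if d b = -1 then (1 : Matrix α α ℂ) a (σ b) * A 0 1 + (1 : Matrix α α ℂ) a b * A 1 1
    else (1 : Matrix α α ℂ) a b

theorem mul_minusculeMatrix_apply (X : Matrix α α ℂ) (A : Matrix (Fin 2) (Fin 2) ℂ) (a b : α) :
    (X * minusculeMatrix σ d A) a b =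
      if d b = 1 then X a b * A 0 0 + X a (σ b) * A 1 0
      else if d b = -1 then X a (σ b) * A 0 1 + X a b * A 1 1
      else X a b := by
  rw [Matrix.mul_apply]
  simp only [minusculeMatrix, Matrix.of_apply, Matrix.one_apply]
  split_ifs <;> simp [mul_add, Finset.sum_add_distrib]

theorem minusculeMatrix_mul_apply (hσ : Function.Involutive σ) (hd : ∀ b, d (σ b) = -d b)
    (A : Matrix (Fin 2) (Fin 2) ℂ) (X : Matrix α α ℂ) (a b : α) :
    (minusculeMatrix σ d A * X) a b =
      if d a = 1 then A 0 0 * X a b + A 0 1 * X (σ a) b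
      else if d a = -1 then A 1 0 * X (σ a) b + A 1 1 * X a b
      else X a b := by
  have htranspose : (minusculeMatrix σ d A)ᵀ = minusculeMatrix σ d Aᵀ := by
    ext a b
    have hab : b = σ a ↔ a = σ b := eq_comm.trans hσ.eq_iff
    by_cases h : b = σ a
    · have hne (h0 : d a ≠ 0) : σ a ≠ a := fun h1 => h0 (by have := hd a; rw [h1] at this; omega)
      by_cases h1 : d a = 1
      · simp [minusculeMatrix, Matrix.one_apply, h, hd, hσ a, h1, hne, (hne _).symm]
      · by_cases h2 : d a = -1
        · simp [minusculeMatrix, Matrix.one_apply, h, hd, hσ a, h2, hne, (hne _).symm]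
        · simp [minusculeMatrix, Matrix.one_apply, h, hd, h1, h2, neg_eq_iff_eq_neg, eq_comm]
    · by_cases hb : a = b
      · subst hb
        simp [minusculeMatrix, Matrix.one_apply, h]
      · simp [minusculeMatrix, Matrix.one_apply, h, hb, Ne.symm hb, mt hab.2 h]
  rw [← Matrix.transpose_apply (_ * X), Matrix.transpose_mul, htranspose,
    mul_minusculeMatrix_apply]
  simp only [Matrix.transpose_apply, mul_comm]

/-- For an involution `σ` negating the weights `d`, the representation `minusculeMatrix σ d` of the
monoid of `2 × 2` matrices. -/
def minusculeHom (hσ : Function.Involutive σ) (hd : ∀ b, d (σ b) = -d b) :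
    Matrix (Fin 2) (Fin 2) ℂ →* Matrix α α ℂ where
  toFun := minusculeMatrix σ d
  map_one' := by
    ext a b
    simp [minusculeMatrix]
  map_mul' A B := by
    ext a b
    rw [mul_minusculeMatrix_apply]
    by_cases h1 : d b = 1
    · simp only [minusculeMatrix, Matrix.of_apply, h1, hd, Matrix.mul_apply, Fin.sum_univ_two,
        if_true, if_neg (by decide : ¬(-1 : ℤ) = 1)]
      rw [hσ b]
      ring
    · by_cases h2 : d b = -1
      · simp only [minusculeMatrix, Matrix.of_apply, h2, hd, Matrix.mul_apply, Fin.sum_univ_two,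
          if_true, if_neg (by decide : ¬(-1 : ℤ) = 1), neg_neg]
        rw [hσ b]
        ring
      · simp [minusculeMatrix, h1, h2]

theorem minusculeHom_apply (hσ : Function.Involutive σ) (hd : ∀ b, d (σ b) = -d b)
    (A : Matrix (Fin 2) (Fin 2) ℂ) : minusculeHom hσ hd A = minusculeMatrix σ d A := rfl

theorem mul_raise_apply (A : Matrix α α ℂ) (a b : α) :
    (A * raise σ d) a b = if d b = -1 then A a (σ b) else 0 := by
  simp [Matrix.mul_apply, raise, ite_and]

theorem mul_lower_apply (A : Matrix α α ℂ) (a b : α) :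
    (A * lower σ d) a b = if d b = 1 then A a (σ b) else 0 := by
  simp [Matrix.mul_apply, lower, ite_and]

theorem raise_sq (hd : ∀ b, d (σ b) = -d b) : raise σ d ^ 2 = 0 := by
  ext a b
  rw [pow_two, mul_raise_apply]
  simp +contextual [raise, hd]

theorem lower_sq (hd : ∀ b, d (σ b) = -d b) : lower σ d ^ 2 = 0 := by
  ext a b
  rw [pow_two, mul_lower_apply]
  simp +contextual [lower, hd]

theorem integrates_minusculeHom (hσ : Function.Involutive σ) (hd : ∀ b, d (σ b) = -d b)
    (hd_mem : ∀ b, d b = -1 ∨ d b = 0 ∨ d b = 1) :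
    Integrates (minusculeHom hσ hd) (raise σ d) (lower σ d) d where
  exp_raise t := by
    rw [exp_smul_of_pow_three_eq_zero (pow_eq_zero_of_le (by simp) (raise_sq hd)), raise_sq hd]
    ext a b
    rcases hd_mem b with h | h | h <;>
      simp [minusculeHom_apply, minusculeMatrix, raise, h, Matrix.one_apply, add_comm]
  exp_lower t := by
    rw [exp_smul_of_pow_three_eq_zero (pow_eq_zero_of_le (by simp) (lower_sq hd)), lower_sq hd]
    ext a b
    rcases hd_mem b with h | h | h <;>
      simp [minusculeHom_apply, minusculeMatrix, lower, h, Matrix.one_apply]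
  map_diagonal c := by
    ext a b
    rcases hd_mem b with h | h | h <;> by_cases hab : a = b <;>
      simp [minusculeHom_apply, minusculeMatrix, h, hab, Matrix.one_apply]
  lie_eq := by
    ext a b
    rw [Matrix.sub_apply, mul_lower_apply, mul_raise_apply]
    rcases hd_mem b with h | h | h <;> by_cases hab : a = b <;>
      simp [raise, lower, hd, hσ b, h, hab]

end Minuscule

section SymmetricSquare

/-- The symmetric square of the tautological representation, in the basis `u²`, `2uv`, `v²`, where
`u`, `v` is the standard basis. -/
def symSquareHom : Matrix (Fin 2) (Fin 2) ℂ →* Matrix (Fin 3) (Fin 3) ℂ where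
  toFun A := !![A 0 0 ^ 2, 2 * A 0 0 * A 0 1, A 0 1 ^ 2;
    A 0 0 * A 1 0, A 0 0 * A 1 1 + A 0 1 * A 1 0, A 0 1 * A 1 1;
    A 1 0 ^ 2, 2 * A 1 0 * A 1 1, A 1 1 ^ 2]
  map_one' := by
    ext i j
    fin_cases i <;> fin_cases j <;> simp
  map_mul' A B := by
    ext i j
    fin_cases i <;> fin_cases j <;>
      simp [Matrix.mul_apply, Fin.sum_univ_three, Fin.sum_univ_two] <;> ring

theorem symSquareHom_apply (A : Matrix (Fin 2) (Fin 2) ℂ) :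
    symSquareHom A = !![A 0 0 ^ 2, 2 * A 0 0 * A 0 1, A 0 1 ^ 2;
      A 0 0 * A 1 0, A 0 0 * A 1 1 + A 0 1 * A 1 0, A 0 1 * A 1 1;
      A 1 0 ^ 2, 2 * A 1 0 * A 1 1, A 1 1 ^ 2] := rfl

/-- The weights of the symmetric square of the tautological representation. -/
def symSquareWt : Fin 3 → ℤ := ![2, 0, -2]

/-- The derivative of the symmetric square of `!![1, t; 0, 1]` at `t = 0`. -/
def symSquareRaise : Matrix (Fin 3) (Fin 3) ℂ := !![0, 2, 0; 0, 0, 1; 0, 0, 0]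

/-- The derivative of the symmetric square of `!![1, 0; t, 1]` at `t = 0`. -/
def symSquareLower : Matrix (Fin 3) (Fin 3) ℂ := !![0, 0, 0; 1, 0, 0; 0, 2, 0]

theorem symSquareRaise_pow_three : symSquareRaise ^ 3 = 0 := by
  ext i j
  fin_cases i <;> fin_cases j <;>
    simp [symSquareRaise, pow_succ, Matrix.mul_apply, Fin.sum_univ_three]

theorem symSquareLower_pow_three : symSquareLower ^ 3 = 0 := by
  ext i j
  fin_cases i <;> fin_cases j <;>
    simp [symSquareLower, pow_succ, Matrix.mul_apply, Fin.sum_univ_three]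

theorem integrates_symSquareHom :
    Integrates symSquareHom symSquareRaise symSquareLower symSquareWt where
  exp_raise t := by
    rw [exp_smul_of_pow_three_eq_zero symSquareRaise_pow_three]
    ext i j
    fin_cases i <;> fin_cases j <;> simp [symSquareHom_apply, symSquareRaise, pow_two]; ring
  exp_lower t := by
    rw [exp_smul_of_pow_three_eq_zero symSquareLower_pow_three]
    ext i j
    fin_cases i <;> fin_cases j <;> simp [symSquareHom_apply, symSquareLower, pow_two]; ring
  map_diagonal c := by
    ext i j
    fin_cases i <;> fin_cases j <;> simp [symSquareHom_apply, symSquareWt, zpow_neg]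
  lie_eq := by
    ext i j
    fin_cases i <;> fin_cases j <;>
      simp [symSquareWt, symSquareRaise, symSquareLower]

end SymmetricSquare

section Extension

variable {α κ : Type*} [DecidableEq α] [Fintype κ] {ι : κ → α}

/-- The matrix of the inclusion of the span of the basis vectors `ι k`. -/
def inclusion (ι : κ → α) : Matrix α κ ℂ := (1 : Matrix α α ℂ).submatrix id ι

/-- The embedding of matrices on the span of the basis vectors `ι k`. -/
def embed (ι : κ → α) (A : Matrix κ κ ℂ) : Matrix α α ℂ := inclusion ι * A * (inclusion ι)ᵀ

theorem embed_add (A B : Matrix κ κ ℂ) : embed ι (A + B) = embed ι A + embed ι B := by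
  simp only [embed, Matrix.mul_add, Matrix.add_mul]

theorem embed_sub (A B : Matrix κ κ ℂ) : embed ι (A - B) = embed ι A - embed ι B := by
  simp only [embed, Matrix.mul_sub, Matrix.sub_mul]

theorem embed_smul (t : ℂ) (A : Matrix κ κ ℂ) : embed ι (t • A) = t • embed ι A := by
  simp only [embed, Matrix.mul_smul, Matrix.smul_mul]

theorem embed_diagonal [DecidableEq κ] (hι : Function.Injective ι) {v : κ → ℂ} {w : α → ℂ}
    (hv : ∀ k, w (ι k) = v k) (hw : ∀ b ∉ Set.range ι, w b = 0) :
    embed ι (Matrix.diagonal v) = Matrix.diagonal w := by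
  ext a b
  rw [embed, Matrix.mul_apply]
  simp only [inclusion, Matrix.mul_diagonal, Matrix.submatrix_apply, Matrix.transpose_apply]
  by_cases hb : b ∈ Set.range ι
  · obtain ⟨k, rfl⟩ := hb
    by_cases ha : a = ι k <;> simp [Matrix.one_apply, hι.eq_iff, ha, hv]
  · have hb' (k : κ) : b ≠ ι k := fun h => hb ⟨k, h.symm⟩
    by_cases hab : a = b <;> simp [hb', hw b hb, hab]

variable [Fintype α]

theorem embed_mul_embed (hι : Function.Injective ι) (A B : Matrix κ κ ℂ) :
    embed ι A * embed ι B = embed ι (A * B) := by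
  classical
  have hone : (inclusion ι)ᵀ * inclusion ι = 1 := by
    ext k l
    simp [inclusion, Matrix.mul_apply, Matrix.one_apply, hι.eq_iff]
  calc embed ι A * embed ι B
      = inclusion ι * A * ((inclusion ι)ᵀ * inclusion ι) * B * (inclusion ι)ᵀ := by
        simp only [embed, Matrix.mul_assoc]
    _ = embed ι (A * B) := by rw [hone, Matrix.mul_one, embed, Matrix.mul_assoc _ A]

variable [DecidableEq κ]

theorem embed_pow_succ (hι : Function.Injective ι) (A : Matrix κ κ ℂ) (m : ℕ) :
    embed ι A ^ (m + 1) = embed ι (A ^ (m + 1)) := by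
  induction m with
  | zero => simp
  | succ m ih => rw [pow_succ, ih, embed_mul_embed hι, ← pow_succ]

theorem exp_smul_embed (hι : Function.Injective ι) {e : Matrix κ κ ℂ} (he : e ^ 3 = 0) (t : ℂ) :
    NormedSpace.exp (t • embed ι e) = 1 + embed ι (NormedSpace.exp (t • e) - 1) := by
  have he' : embed ι e ^ 3 = 0 := by
    rw [embed_pow_succ hι, he, embed, Matrix.mul_zero, Matrix.zero_mul]
  rw [exp_smul_of_pow_three_eq_zero he, exp_smul_of_pow_three_eq_zero he', embed_pow_succ hι,
    add_assoc, add_assoc, add_sub_cancel_left, embed_add, embed_smul, embed_smul]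

/-- The extension of a representation on the span of the basis vectors `ι k` by the trivial
representation on the remaining basis vectors. -/
def extendHom {M : Type*} [Monoid M] (hι : Function.Injective ι) (φ : M →* Matrix κ κ ℂ) :
    M →* Matrix α α ℂ where
  toFun A := 1 + embed ι (φ A - 1)
  map_one' := by simp [embed]
  map_mul' A B := by
    have h : φ (A * B) - 1 = (φ A - 1) * (φ B - 1) + (φ A - 1) + (φ B - 1) := by
      rw [map_mul]
      noncomm_ring
    rw [h, embed_add, embed_add, ← embed_mul_embed hι]
    noncomm_ring

theorem extendHom_apply {M : Type*} [Monoid M] (hι : Function.Injective ι)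
    (φ : M →* Matrix κ κ ℂ) (A : M) : extendHom hι φ A = 1 + embed ι (φ A - 1) := rfl

theorem Integrates.extend {φ : Matrix (Fin 2) (Fin 2) ℂ →* Matrix κ κ ℂ} {e f : Matrix κ κ ℂ}
    {d : κ → ℤ} (hφ : Integrates φ e f d) (he : e ^ 3 = 0) (hf : f ^ 3 = 0)
    (hι : Function.Injective ι) {d' : α → ℤ} (hd : ∀ k, d' (ι k) = d k)
    (hd' : ∀ b ∉ Set.range ι, d' b = 0) :
    Integrates (extendHom hι φ) (embed ι e) (embed ι f) d' where
  exp_raise t := by rw [exp_smul_embed hι he, hφ.exp_raise, extendHom_apply]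
  exp_lower t := by rw [exp_smul_embed hι hf, hφ.exp_lower, extendHom_apply]
  map_diagonal c := by
    rw [extendHom_apply, hφ.map_diagonal, ← Matrix.diagonal_one (n := κ), Matrix.diagonal_sub,
      embed_diagonal hι (w := fun b => (c : ℂ) ^ d' b - 1), ← Matrix.diagonal_one,
      Matrix.diagonal_add]
    · simp
    · simp [hd]
    · simp +contextual [hd']
  lie_eq := by
    rw [embed_mul_embed hι, embed_mul_embed hι, ← embed_sub, hφ.lie_eq]
    exact embed_diagonal hι (by simp [hd]) (by simp +contextual [hd'])

end Extension

section Weights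

/-- The coordinate `⟨h_i, ε_j⟩` of the weight `ε_j` of `v_j`. -/
def epsWt (i j : Fin n) : ℤ :=
  if j = i then (if i.val + 1 < n then 1 else 2) else if j.val = i.val + 1 then -1 else 0

/-- The coordinate `⟨h_i, wt⟩` of the weight of a basis vector of `V(Λ_1)`. -/
def vecWt (i : Fin n) : VecIdx n → ℤ
  | .inl j => epsWt i j
  | .inr (.inl _) => 0
  | .inr (.inr j) => -epsWt i j

/-- The coordinate `⟨h_i, wt⟩` of the weight of a basis vector of `V(Λ_n)`. -/
def spinWt (i : Fin n) (b : SpinIdx n) : ℤ :=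
  if h : i.val + 1 < n then
    (if b i then 1 else 0) - (if b ⟨i.val + 1, h⟩ then 1 else 0)
  else if b i then 1 else -1

/-- The weight of a basis vector of `V(Λ_1) ⊕ V(Λ_n)`. -/
def wt (b : Idx n) : Weight n := fun i => Sum.elim (vecWt i) (spinWt i) b

/-- The permutation of the indices `1, …, n` induced by a simple reflection. -/
def nodeSwap (i : Fin n) : Equiv.Perm (Fin n) :=
  if h : i.val + 1 < n then Equiv.swap i ⟨i.val + 1, h⟩ else 1

/-- The permutation of the weights of `V(Λ_1)` induced by a simple reflection. -/
def vecSwap (i : Fin n) : Equiv.Perm (VecIdx n) :=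
  if i.val + 1 < n then Equiv.sumCongr (nodeSwap i) (Equiv.sumCongr 1 (nodeSwap i))
  else Equiv.swap (.inl i) (.inr (.inr i))

/-- The permutation of the weights of `V(Λ_n)` induced by a simple reflection. -/
def spinSwap (i : Fin n) (b : SpinIdx n) : SpinIdx n :=
  if i.val + 1 < n then b ∘ nodeSwap i else Function.update b i (!b i)

theorem nodeSwap_apply {i : Fin n} (h : i.val + 1 < n) (j : Fin n) :
    nodeSwap i j = if j = i then ⟨i.val + 1, h⟩ else if j.val = i.val + 1 then i else j := by
  simp [nodeSwap, h, Equiv.swap_apply_def, Fin.ext_iff]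

theorem nodeSwap_nodeSwap (i j : Fin n) : nodeSwap i (nodeSwap i j) = j := by
  unfold nodeSwap
  split_ifs <;> simp

theorem vecSwap_inl (i j : Fin n) : vecSwap i (.inl j) =
    if i.val + 1 < n then .inl (nodeSwap i j)
    else if j = i then .inr (.inr i) else .inl j := by
  unfold vecSwap
  split_ifs <;> simp_all [Equiv.swap_apply_def]

theorem vecSwap_inr_inl (i : Fin n) : vecSwap i (.inr (.inl ())) = .inr (.inl ()) := by
  unfold vecSwap
  split_ifs <;> simp [Equiv.swap_apply_def]

theorem vecSwap_inr_inr (i j : Fin n) : vecSwap i (.inr (.inr j)) =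
    if i.val + 1 < n then .inr (.inr (nodeSwap i j))
    else if j = i then .inl i else .inr (.inr j) := by
  unfold vecSwap
  split_ifs <;> simp_all [Equiv.swap_apply_def]

theorem vecSwap_involutive (i : Fin n) : Function.Involutive (vecSwap i) := by
  intro b
  unfold vecSwap
  split_ifs with h
  · rcases b with j | u | j <;> simp [nodeSwap_nodeSwap]
  · simp

theorem spinSwap_involutive (i : Fin n) : Function.Involutive (spinSwap i) := by
  intro b
  unfold spinSwap
  split_ifs
  · ext j
    simp [nodeSwap_nodeSwap]
  · simp

theorem epsWt_nodeSwap {i : Fin n} (h : i.val + 1 < n) (j : Fin n) :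
    epsWt i (nodeSwap i j) = -epsWt i j := by
  have hi : (⟨i.val + 1, h⟩ : Fin n) ≠ i := by simp [Fin.ext_iff]
  rw [nodeSwap_apply h]
  by_cases h1 : j = i
  · simp [epsWt, h, h1, hi]
  · by_cases h2 : j.val = i.val + 1 <;> simp [epsWt, h, h1, h2]

theorem vecWt_vecSwap (i : Fin n) (b : VecIdx n) : vecWt i (vecSwap i b) = -vecWt i b := by
  rcases b with j | u | j
  · rw [vecSwap_inl]
    split_ifs with h hj
    · exact epsWt_nodeSwap h j
    · simp [vecWt, hj]
    · have hj' : j.val ≠ i.val + 1 := by omega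
      simp [vecWt, epsWt, hj, hj']
  · rw [vecSwap_inr_inl]
    rfl
  · rw [vecSwap_inr_inr]
    split_ifs with h hj
    · simp [vecWt, epsWt_nodeSwap h]
    · simp [vecWt, hj]
    · have hj' : j.val ≠ i.val + 1 := by omega
      simp [vecWt, epsWt, hj, hj']

theorem spinWt_spinSwap (i : Fin n) (b : SpinIdx n) : spinWt i (spinSwap i b) = -spinWt i b := by
  by_cases h : i.val + 1 < n
  · have hi : (⟨i.val + 1, h⟩ : Fin n) ≠ i := by simp [Fin.ext_iff]
    simp [spinSwap, spinWt, h, nodeSwap_apply h, hi]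
  · cases hb : b i <;> simp [spinSwap, spinWt, h, hb]

end Weights

section Homomorphisms

theorem vecE_eq_raise {i : Fin n} (h : i.val + 1 < n) : vecE i = raise (vecSwap i) (vecWt i) := by
  have hn : i.val + 1 ≠ n := by omega
  ext a b
  rcases b with j | u | j <;> rcases a with k | u' | k <;>
    simp only [vecE, raise, Matrix.of_apply, vecSwap_inl, vecSwap_inr_inr, vecWt, epsWt, h, hn,
      nodeSwap_apply h] <;>
    simp [Fin.ext_iff]
  all_goals split_ifs <;> simp_all

theorem vecF_eq_lower {i : Fin n} (h : i.val + 1 < n) : vecF i = lower (vecSwap i) (vecWt i) := by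
  have hn : i.val + 1 ≠ n := by omega
  ext a b
  rcases b with j | u | j <;> rcases a with k | u' | k <;>
    simp only [vecF, lower, Matrix.of_apply, vecSwap_inl, vecSwap_inr_inr, vecWt, epsWt, h, hn,
      nodeSwap_apply h] <;>
    simp [Fin.ext_iff]
  all_goals split_ifs <;> simp_all

theorem spinE_eq_raise (i : Fin n) : spinE i = raise (spinSwap i) (spinWt i) := by
  ext a b
  by_cases h : i.val + 1 < n
  · have : (⟨i.val + 1, h⟩ : Fin n) ≠ i := by simp [Fin.ext_iff]
    have hswap (h1 : b i = false) (h2 : b ⟨i.val + 1, h⟩ = true) :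
        Function.update (Function.update b i true) ⟨i.val + 1, h⟩ false = b ∘ nodeSwap i := by
      ext j
      simp only [Function.update_apply, Function.comp_apply, nodeSwap_apply h, Fin.ext_iff]
      split_ifs <;> simp_all
    cases h1 : b i <;> cases h2 : b ⟨i.val + 1, h⟩ <;>
      simp [spinE, raise, spinSwap, spinWt, h, h1, h2, hswap]
  · cases h1 : b i <;> simp [spinE, raise, spinSwap, spinWt, h, h1]

theorem spinF_eq_lower (i : Fin n) : spinF i = lower (spinSwap i) (spinWt i) := by
  ext a b
  by_cases h : i.val + 1 < n
  · have : (⟨i.val + 1, h⟩ : Fin n) ≠ i := by simp [Fin.ext_iff]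
    have hswap (h1 : b i = true) (h2 : b ⟨i.val + 1, h⟩ = false) :
        Function.update (Function.update b i false) ⟨i.val + 1, h⟩ true = b ∘ nodeSwap i := by
      ext j
      simp only [Function.update_apply, Function.comp_apply, nodeSwap_apply h, Fin.ext_iff]
      split_ifs <;> simp_all
    cases h1 : b i <;> cases h2 : b ⟨i.val + 1, h⟩ <;>
      simp [spinF, lower, spinSwap, spinWt, h, h1, h2, hswap]
  · cases h1 : b i <;> simp [spinF, lower, spinSwap, spinWt, h, h1]

/-- The basis vectors `v_j`, `v_0`, `v_{j̄}`, which for `j = n` span the nontrivial summand of the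
vector representation of the `SL₂` of the short simple root. -/
def shortNode (j : Fin n) : Fin 3 → VecIdx n := ![.inl j, .inr (.inl ()), .inr (.inr j)]

theorem shortNode_injective (j : Fin n) : Function.Injective (shortNode j) := by
  intro a b h
  fin_cases a <;> fin_cases b <;> simp_all [shortNode]

theorem embed_apply {α κ : Type*} [DecidableEq α] [Fintype κ] (ι : κ → α) (A : Matrix κ κ ℂ)
    (a b : α) :
    embed ι A a b = ∑ l, (∑ k, if a = ι k then A k l else 0) * if b = ι l then 1 else 0 := by
  rw [embed, Matrix.mul_apply]
  simp [inclusion, Matrix.mul_apply, Matrix.one_apply]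

theorem vecE_eq_embed {i : Fin n} (h : i.val + 1 = n) :
    vecE i = embed (shortNode i) symSquareRaise := by
  ext a b
  rw [embed_apply]
  rcases b with j | u | j <;> rcases a with k | u' | k <;>
    simp [vecE, shortNode, symSquareRaise, Fin.sum_univ_three, h, and_comm] <;> omega

theorem vecF_eq_embed {i : Fin n} (h : i.val + 1 = n) :
    vecF i = embed (shortNode i) symSquareLower := by
  ext a b
  rw [embed_apply]
  rcases b with j | u | j <;> rcases a with k | u' | k <;>
    simp [vecF, shortNode, symSquareLower, Fin.sum_univ_three, h, and_comm] <;> omega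

/-- The action of the `i`-th `SL₂` on `V(Λ_1)`. -/
def vecHom (i : Fin n) : Matrix (Fin 2) (Fin 2) ℂ →* Matrix (VecIdx n) (VecIdx n) ℂ :=
  if i.val + 1 < n then minusculeHom (vecSwap_involutive i) (vecWt_vecSwap i)
  else extendHom (shortNode_injective i) symSquareHom

/-- The action of the `i`-th `SL₂` on `V(Λ_n)`. -/
def spinHom (i : Fin n) : Matrix (Fin 2) (Fin 2) ℂ →* Matrix (SpinIdx n) (SpinIdx n) ℂ :=
  minusculeHom (spinSwap_involutive i) (spinWt_spinSwap i)

/-- The homomorphism `φ_i` in the representation `V(Λ_1) ⊕ V(Λ_n)`. -/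
def genHom (i : Fin n) : Matrix (Fin 2) (Fin 2) ℂ →* Matrix (Idx n) (Idx n) ℂ :=
  blockSum (vecHom i) (spinHom i)

theorem vecWt_shortNode {i : Fin n} (h : ¬i.val + 1 < n) (k : Fin 3) :
    vecWt i (shortNode i k) = symSquareWt k := by
  fin_cases k <;> simp [vecWt, epsWt, shortNode, symSquareWt, h]

theorem vecWt_eq_zero_of_notMem_shortNode {i : Fin n} (h : ¬i.val + 1 < n) (b : VecIdx n)
    (hb : b ∉ Set.range (shortNode i)) : vecWt i b = 0 := by
  have heps (j : Fin n) (hj : j ≠ i) : epsWt i j = 0 := by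
    have : j.val ≠ i.val + 1 := by omega
    simp [epsWt, hj, this]
  rcases b with j | u | j
  · exact heps j fun hj => hb ⟨0, by simp [shortNode, hj]⟩
  · rfl
  · exact neg_eq_zero.2 (heps j fun hj => hb ⟨2, by simp [shortNode, hj]⟩)

theorem vecWt_mem_of_lt {i : Fin n} (h : i.val + 1 < n) (b : VecIdx n) :
    vecWt i b = -1 ∨ vecWt i b = 0 ∨ vecWt i b = 1 := by
  rcases b with j | u | j <;> simp only [vecWt, epsWt, h, if_true]
  · split_ifs <;> simp
  · simp
  · split_ifs <;> simp

theorem integrates_vecHom (i : Fin n) : Integrates (vecHom i) (vecE i) (vecF i) (vecWt i) := by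
  unfold vecHom
  split_ifs with h
  · rw [vecE_eq_raise h, vecF_eq_lower h]
    exact integrates_minusculeHom _ _ (vecWt_mem_of_lt h)
  · have hn : i.val + 1 = n := by omega
    rw [vecE_eq_embed hn, vecF_eq_embed hn]
    exact integrates_symSquareHom.extend symSquareRaise_pow_three symSquareLower_pow_three
      (shortNode_injective i) (vecWt_shortNode h) (vecWt_eq_zero_of_notMem_shortNode h)

theorem integrates_spinHom (i : Fin n) :
    Integrates (spinHom i) (spinE i) (spinF i) (spinWt i) := by
  rw [spinE_eq_raise, spinF_eq_lower]
  refine integrates_minusculeHom _ _ fun b => ?_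
  unfold spinWt
  split_ifs <;> simp

theorem integrates_genHom (i : Fin n) :
    Integrates (genHom i) (genE i) (genF i) (fun b => wt b i) := by
  have h := (integrates_vecHom i).blockSum (integrates_spinHom i)
  rwa [show Sum.elim (vecWt i) (spinWt i) = fun b => wt b i by ext (b | b) <;> rfl] at h

end Homomorphisms

section OneParameter

theorem coe_x (i : Fin n) (t : ℂ) : (x i t).1.1 = genHom i !![1, t; 0, 1] :=
  (integrates_genHom i).exp_raise t

theorem coe_y (i : Fin n) (t : ℂ) : (y i t).1.1 = genHom i !![1, 0; t, 1] :=
  (integrates_genHom i).exp_lower t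

theorem coe_coroot (i : Fin n) (c : ℂˣ) :
    (coroot i c).1.1 = genHom i !![(c : ℂ), 0; 0, (c : ℂ)⁻¹] := by
  simp only [coroot, Subgroup.coe_mul, Units.val_mul, coe_x, coe_y, ← map_mul]
  congr 1
  ext a b
  fin_cases a <;> fin_cases b <;> simp

theorem coe_coroot_eq_diagonal (i : Fin n) (c : ℂˣ) :
    (coroot i c).1.1 = Matrix.diagonal fun b => (c : ℂ) ^ wt b i := by
  rw [coe_coroot, (integrates_genHom i).map_diagonal]

theorem coe_sBar (i : Fin n) : (sBar i).1.1 = genHom i !![0, -1; 1, 0] := by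
  simp only [sBar, Subgroup.coe_mul, Units.val_mul, coe_x, coe_y, ← map_mul]
  congr 1
  ext a b
  fin_cases a <;> fin_cases b <;> simp

theorem coe_yBold (i : Fin n) (c : ℂˣ) :
    (yBold i c).1.1 = genHom i !![(c : ℂ)⁻¹, 0; 1, (c : ℂ)] := by
  simp only [yBold, Subgroup.coe_mul, Units.val_mul, coe_coroot, coe_y, ← map_mul]
  congr 1
  ext a b
  fin_cases a <;> fin_cases b <;> simp

theorem x_mul_y (i : Fin n) (s t : ℂ) (u : ℂˣ) (hu : (u : ℂ) = 1 + s * t) :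
    x i s * y i t = y i (t / u) * coroot i u * x i (s / u) := by
  apply Subtype.ext
  apply Units.ext
  simp only [Subgroup.coe_mul, Units.val_mul, coe_coroot, coe_x, coe_y, ← map_mul]
  congr 1
  have hu0 : 1 + s * t ≠ 0 := hu ▸ u.ne_zero
  have hu1 : 1 + t * s ≠ 0 := mul_comm s t ▸ hu0
  ext a b
  fin_cases a <;> fin_cases b <;> simp [hu] <;> field_simp
  ring

end OneParameter

section Heights

/-- The height of a basis vector of `V(Λ_1)`: half of its eigenvalue under `2ρ^∨`. -/
def height : VecIdx n → ℤ
  | .inl j => n - j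
  | .inr (.inl _) => 0
  | .inr (.inr j) => -(n - j)

theorem height_injective : Function.Injective (height : VecIdx n → ℤ) := by
  intro a b h
  rcases a with j | u | j <;> rcases b with k | u' | k <;> simp only [height] at h
  all_goals first | rfl | omega | skip
  · rw [Fin.ext (by omega : j.val = k.val)]
  · rw [Fin.ext (by omega : j.val = k.val)]

/-- The coefficient of `h_i` in `4ρ^∨`; the factor `4` makes all of them integers divisible
by `2`. -/
def rhoCoeff (i : Fin n) : ℤ :=
  if i.val + 1 < n then 2 * (i + 1) * (2 * n - i) else n * (n + 1)

/-- The pairing of a weight with `4ρ^∨`. -/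
def rhoPairing : Weight n →ₗ[ℤ] ℤ := ∑ i, rhoCoeff i • LinearMap.proj i

theorem rhoPairing_wt (b : VecIdx n) : rhoPairing (wt (.inl b)) = 4 * height b := by
  have heps (j : Fin n) : rhoPairing (fun i => epsWt i j) = 4 * (n - j) := by
    have hsplit (i : Fin n) : epsWt i j =
        (if i = j then (if j.val + 1 < n then 1 else 2) else 0) -
          if i.val + 1 = j.val then 1 else 0 := by
      simp only [epsWt, Fin.ext_iff]
      split_ifs <;> omega
    have hpred : (∑ i : Fin n, if i.val + 1 = j.val then rhoCoeff i else 0) =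
        2 * j * (2 * n + 1 - j) := by
      rcases hj : j.val with _ | m
      · simp
      · have hm : m + 1 < n := hj ▸ j.isLt
        rw [Finset.sum_eq_single ⟨m, by omega⟩
          (fun i _ hi => if_neg (by simpa [Fin.ext_iff] using hi)) (by simp)]
        simp only [rhoCoeff, hm, if_true]
        push_cast
        ring
    simp only [rhoPairing, LinearMap.sum_apply, LinearMap.smul_apply, LinearMap.proj_apply,
      smul_eq_mul, hsplit, mul_sub, Finset.sum_sub_distrib, mul_ite, mul_zero, Finset.sum_ite_eq',
      Finset.mem_univ, if_true, mul_one, hpred]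
    unfold rhoCoeff
    split_ifs with h
    · ring
    · rw [show (n : ℤ) = j + 1 by omega]
      ring
  rcases b with j | _ | j
  · exact heps j
  · exact map_zero _
  · rw [show wt (.inl (.inr (.inr j))) = -fun i => epsWt i j from rfl, map_neg, heps, height]
    ring

theorem simpleRoot_eq_wt_sub {i : Fin n} (h : i.val + 1 < n) :
    simpleRoot i = wt (.inl (.inl i)) - wt (.inl (.inl ⟨i.val + 1, h⟩)) := by
  ext m
  simp only [simpleRoot, cartan, Pi.sub_apply, wt, Sum.elim_inl, vecWt, epsWt, Fin.ext_iff]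
  split_ifs <;> omega

theorem simpleRoot_eq_wt {i : Fin n} (h : i.val + 1 = n) :
    simpleRoot i = wt (.inl (.inl i)) := by
  ext m
  simp only [simpleRoot, cartan, wt, Sum.elim_inl, vecWt, epsWt, Fin.ext_iff]
  split_ifs <;> omega

theorem rhoPairing_simpleRoot (i : Fin n) : rhoPairing (simpleRoot i) = 4 := by
  by_cases h : i.val + 1 < n
  · rw [simpleRoot_eq_wt_sub h, map_sub, rhoPairing_wt, rhoPairing_wt, height, height]
    push_cast
    ring
  · rw [simpleRoot_eq_wt (by omega), rhoPairing_wt, height]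
    omega

theorem IsPositive.rhoPairing_pos {α : Weight n} (hα : IsPositive α) : 0 < rhoPairing α := by
  obtain ⟨hne, m, rfl⟩ := hα
  simp only [map_sum, map_smul, rhoPairing_simpleRoot, smul_eq_mul]
  by_contra! hle
  refine hne (Finset.sum_eq_zero fun j _ => ?_)
  have hj : ((m j : ℤ) * 4) ≤ 0 :=
    (Finset.single_le_sum (f := fun j => (m j : ℤ) * 4) (fun _ _ => by positivity)
      (Finset.mem_univ j)).trans hle
  rw [show (m j : ℤ) = 0 by omega, zero_smul]

end Heights

section BlockDiagonal

attribute [local instance] LieRing.ofAssociativeRing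

theorem genH_eq_diagonal (i : Fin n) : genH i = Matrix.diagonal fun b => (wt b i : ℂ) := by
  rw [genH, LieRing.of_associative_ring_bracket]
  exact (integrates_genHom i).lie_eq

theorem wt_sub_of_mem_rootSpace {α : Weight n} {z : Matrix (Idx n) (Idx n) ℂ}
    (hz : z ∈ rootSpace α) {a b : Idx n} (h : z a b ≠ 0) : wt a - wt b = α := by
  ext i
  have hi := congrFun (congrFun (hz.2 i) a) b
  rw [genH_eq_diagonal, LieRing.of_associative_ring_bracket, Matrix.sub_apply,
    Matrix.diagonal_mul, Matrix.mul_diagonal, mul_comm (z a b), ← sub_mul, Matrix.smul_apply,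
    smul_eq_mul] at hi
  exact_mod_cast mul_right_cancel₀ h hi

theorem exists_eq_fromBlocks_of_mem_lieAlg {z : Matrix (Idx n) (Idx n) ℂ} (hz : z ∈ lieAlg n) :
    ∃ A B, z = Matrix.fromBlocks A 0 0 B := by
  induction hz using LieSubalgebra.lieSpan_induction with
  | mem z hz =>
    obtain ⟨i, rfl⟩ | ⟨i, rfl⟩ := hz
    · exact ⟨_, _, rfl⟩
    · exact ⟨_, _, rfl⟩
  | zero => exact ⟨0, 0, Matrix.fromBlocks_zero.symm⟩
  | add _ _ _ _ hz hw =>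
    obtain ⟨A, B, rfl⟩ := hz
    obtain ⟨A', B', rfl⟩ := hw
    exact ⟨A + A', B + B', by simp [Matrix.fromBlocks_add]⟩
  | smul t _ _ hz =>
    obtain ⟨A, B, rfl⟩ := hz
    exact ⟨t • A, t • B, by simp [Matrix.fromBlocks_smul]⟩
  | lie _ _ _ _ hz hw =>
    obtain ⟨A, B, rfl⟩ := hz
    obtain ⟨A', B', rfl⟩ := hw
    refine ⟨A * A' - A' * A, B * B' - B' * B, ?_⟩
    simp [LieRing.of_associative_ring_bracket, Matrix.fromBlocks_multiply, sub_eq_add_neg,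
      Matrix.fromBlocks_neg, Matrix.fromBlocks_add]

end BlockDiagonal

section VectorRepresentation

theorem x_inv (i : Fin n) (t : ℂ) : (x i t)⁻¹ = x i (-t) := by
  refine inv_eq_of_mul_eq_one_right (Subtype.ext (Units.ext ?_))
  simp only [Subgroup.coe_mul, Units.val_mul, coe_x, ← map_mul]
  simp [Matrix.one_fin_two.symm]

theorem y_inv (i : Fin n) (t : ℂ) : (y i t)⁻¹ = y i (-t) := by
  refine inv_eq_of_mul_eq_one_right (Subtype.ext (Units.ext ?_))
  simp only [Subgroup.coe_mul, Units.val_mul, coe_y, ← map_mul]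
  simp [Matrix.one_fin_two.symm]

theorem grp_induction {p : grp n → Prop} (one : p 1)
    (mul_x : ∀ g i t, p g → p (g * x i t)) (mul_y : ∀ g i t, p g → p (g * y i t))
    (g : grp n) : p g := by
  obtain ⟨g, hg⟩ := g
  induction hg using Subgroup.closure_induction_right with
  | one => exact one
  | mul_right g hg z hz ih =>
    obtain ⟨i, t, rfl | rfl⟩ := hz
    · exact mul_x ⟨g, hg⟩ i t ih
    · exact mul_y ⟨g, hg⟩ i t ih
  | mul_inv_cancel g hg z hz ih =>
    obtain ⟨i, t, rfl | rfl⟩ := hz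
    · have hmul := mul_x ⟨g, hg⟩ i (-t) ih
      rwa [← x_inv] at hmul
    · have hmul := mul_y ⟨g, hg⟩ i (-t) ih
      rwa [← y_inv] at hmul

theorem exists_eq_fromBlocks (g : grp n) : ∃ A B, g.1.1 = Matrix.fromBlocks A 0 0 B := by
  induction g using grp_induction with
  | one => exact ⟨1, 1, Matrix.fromBlocks_one.symm⟩
  | mul_x g i t hg =>
    obtain ⟨A, B, hg⟩ := hg
    rw [Subgroup.coe_mul, Units.val_mul, hg, coe_x, genHom, blockSum_apply,
      Matrix.fromBlocks_multiply]
    simp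
  | mul_y g i t hg =>
    obtain ⟨A, B, hg⟩ := hg
    rw [Subgroup.coe_mul, Units.val_mul, hg, coe_y, genHom, blockSum_apply,
      Matrix.fromBlocks_multiply]
    simp

variable (n) in
/-- The vector representation `V(Λ_1)` of `G`. -/
def vecRep : grp n →* Matrix (VecIdx n) (VecIdx n) ℂ where
  toFun g := g.1.1.toBlocks₁₁
  map_one' := by
    rw [Subgroup.coe_one, Units.val_one, ← Matrix.fromBlocks_one, Matrix.toBlocks_fromBlocks₁₁]
  map_mul' g h := by
    obtain ⟨A, B, hg⟩ := exists_eq_fromBlocks g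
    obtain ⟨A', B', hh⟩ := exists_eq_fromBlocks h
    simp [hg, hh, Matrix.fromBlocks_multiply]

theorem vecRep_yBold (i : Fin n) (c : ℂˣ) :
    vecRep n (yBold i c) = vecHom i !![(c : ℂ)⁻¹, 0; 1, (c : ℂ)] :=
  congrArg Matrix.toBlocks₁₁ (coe_yBold i c)

end VectorRepresentation

section LeadingMinor

theorem exp_sub_one_mem {α : Type*} [Fintype α] [DecidableEq α]
    (S : NonUnitalSubalgebra ℂ (Matrix α α ℂ)) {z : Matrix α α ℂ} (hz : z ∈ S) :
    NormedSpace.exp z - 1 ∈ S := by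
  have hsum : HasSum (fun m : ℕ => (((m + 1).factorial : ℂ)⁻¹) • z ^ (m + 1))
      (NormedSpace.exp z - 1) := by
    simpa using (hasSum_nat_add_iff' 1).2 (hasSum_matrix_exp z)
  have hpow (m : ℕ) : z ^ (m + 1) ∈ S := by
    induction m with
    | zero => simpa using hz
    | succ m ih => exact pow_succ z (m + 1) ▸ S.mul_mem ih hz
  have hclosed : IsClosed (S : Set (Matrix α α ℂ)) := S.toSubmodule.closed_of_finiteDimensional
  exact hclosed.mem_of_tendsto hsum (.of_forall fun s =>
    S.toSubmodule.sum_mem fun m _ => S.toSubmodule.smul_mem _ (hpow m))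

variable (n) in
/-- The matrices whose row at each `v_j` is supported on the `v_{j'}` with `j' < j`. -/
def strictlyLower : NonUnitalSubalgebra ℂ (Matrix (Idx n) (Idx n) ℂ) where
  carrier := {z | ∀ j b, z (.inl (.inl j)) b ≠ 0 → ∃ j' < j, b = .inl (.inl j')}
  zero_mem' := fun _ _ h => absurd rfl h
  add_mem' := by
    intro z w hz hw j b h
    by_contra hb
    exact h (by rw [Matrix.add_apply, not_not.1 (mt (hz j b) hb), not_not.1 (mt (hw j b) hb),
      add_zero])
  smul_mem' := fun t z hz j b h => hz j b (right_ne_zero_of_mul h)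
  mul_mem' := by
    intro z w hz hw j b h
    obtain ⟨a, -, ha⟩ := Finset.exists_ne_zero_of_sum_ne_zero h
    obtain ⟨j', hj', rfl⟩ := hz j a (left_ne_zero_of_mul ha)
    obtain ⟨j'', hj'', rfl⟩ := hw j' b (right_ne_zero_of_mul ha)
    exact ⟨j'', hj''.trans hj', rfl⟩

/-- The basis vectors `v_1, …, v_{k+1}`. -/
def topIdx (k : Fin n) (j : Fin (k.val + 1)) : VecIdx n := .inl (Fin.castLE k.2 j)

theorem topIdx_injective (k : Fin n) : Function.Injective (topIdx k) :=
  Sum.inl_injective.comp (Fin.castLE_injective k.2)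

/-- The minor on the rows and columns of `v_1, …, v_{k+1}`; for `k + 1 < n` it is the principal
minor of the weight `fundWeight k`. -/
def leadingMinor (k : Fin n) (g : Matrix (Idx n) (Idx n) ℂ) : ℂ :=
  (g.toBlocks₁₁.submatrix (topIdx k) (topIdx k)).det

theorem leadingMinor_transpose (k : Fin n) (g : Matrix (Idx n) (Idx n) ℂ) :
    leadingMinor k gᵀ = leadingMinor k g := by
  rw [leadingMinor, leadingMinor, ← Matrix.det_transpose]
  rfl

theorem leadingMinor_mul_of_sub_one_mem {u : Matrix (Idx n) (Idx n) ℂ}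
    (hu : u - 1 ∈ strictlyLower n) (k : Fin n) (g : Matrix (Idx n) (Idx n) ℂ) :
    leadingMinor k (u * g) = leadingMinor k g := by
  have hrow (j : Fin n) (b : Idx n) (hb : ∀ j' < j, b ≠ .inl (.inl j')) :
      u (.inl (.inl j)) b = (1 : Matrix (Idx n) (Idx n) ℂ) (.inl (.inl j)) b := by
    by_contra h
    obtain ⟨j', hj', rfl⟩ := hu j b (sub_ne_zero.2 h)
    exact hb j' hj' rfl
  have hmul : (u * g).toBlocks₁₁.submatrix (topIdx k) (topIdx k) =
      u.toBlocks₁₁.submatrix (topIdx k) (topIdx k) *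
        g.toBlocks₁₁.submatrix (topIdx k) (topIdx k) := by
    ext j l
    refine (Fintype.sum_of_injective (fun m => (.inl (topIdx k m) : Idx n))
      (Sum.inl_injective.comp (topIdx_injective k)) _ _ (fun b hb => ?_) fun _ => rfl).symm
    have hb' (j' : Fin n) (hj' : j' ≤ Fin.castLE k.2 j) : b ≠ .inl (.inl j') := by
      rintro rfl
      exact hb ⟨⟨j', lt_of_le_of_lt hj' j.2⟩, rfl⟩
    have hzero : u (.inl (topIdx k j)) b = 0 :=
      (hrow _ _ fun j' hj' => hb' j' hj'.le).trans (Matrix.one_apply_ne (hb' _ le_rfl).symm)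
    exact mul_eq_zero_of_left hzero _
  have hdiag (j : Fin (k.val + 1)) : u.toBlocks₁₁ (topIdx k j) (topIdx k j) = 1 := by
    refine (hrow _ _ fun j' hj' h => ?_).trans (Matrix.one_apply_eq _)
    exact hj'.ne' (Sum.inl_injective (Sum.inl_injective h))
  have hlower : (u.toBlocks₁₁.submatrix (topIdx k) (topIdx k)).IsLowerTriangular := by
    intro j l hjl
    have hlt : Fin.castLE k.2 j < Fin.castLE k.2 l := hjl
    refine (hrow _ _ fun j' hj' h => ?_).trans (Matrix.one_apply_ne fun h => ?_)
    · exact (hj'.trans hlt).ne' (Sum.inl_injective (Sum.inl_injective h))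
    · exact hlt.ne (Sum.inl_injective (Sum.inl_injective h))
  rw [leadingMinor, hmul, Matrix.det_mul, Matrix.det_of_isLowerTriangular _ hlower]
  simp [hdiag, leadingMinor]

theorem exp_sub_one_mem_strictlyLower {z : Matrix (Idx n) (Idx n) ℂ}
    (hdiag : ∃ A B, z = Matrix.fromBlocks A 0 0 B)
    (hz : ∀ a b, z a b ≠ 0 → IsPositive (wt b - wt a)) :
    NormedSpace.exp z - 1 ∈ strictlyLower n := by
  refine exp_sub_one_mem _ fun j b hb => ?_
  obtain ⟨A, B, rfl⟩ := hdiag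
  rcases b with b | b
  · have hpos := (hz _ _ hb).rhoPairing_pos
    rw [map_sub, rhoPairing_wt, rhoPairing_wt] at hpos
    rcases b with j' | u | j' <;> simp only [height] at hpos
    · exact ⟨j', Fin.lt_def.2 (by omega), rfl⟩
    · omega
    · omega
  · exact absurd rfl hb

theorem leadingMinor_mul_of_mem_unipNeg (k : Fin n) {u : Ambient n} (hu : u ∈ unipNeg n)
    (g : Matrix (Idx n) (Idx n) ℂ) : leadingMinor k (u.1 * g) = leadingMinor k g := by
  induction hu using Subgroup.closure_induction generalizing g with
  | mem u hu =>
    obtain ⟨α, hα, z, hz, rfl⟩ := hu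
    refine leadingMinor_mul_of_sub_one_mem (exp_sub_one_mem_strictlyLower
      (exists_eq_fromBlocks_of_mem_lieAlg hz.1) fun a b hab => ?_) k g
    rwa [← neg_sub, wt_sub_of_mem_rootSpace hz hab, neg_neg]
  | one => simp
  | mul u v _ _ hu hv => rw [Units.val_mul, mul_assoc, hu, hv]
  | inv u _ hu => rw [← hu, Units.mul_inv_cancel_left]

theorem leadingMinor_mul_of_mem_unipPos (k : Fin n) {u : Ambient n} (hu : u ∈ unipPos n)
    (g : Matrix (Idx n) (Idx n) ℂ) : leadingMinor k (g * u.1) = leadingMinor k g := by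
  induction hu using Subgroup.closure_induction generalizing g with
  | mem u hu =>
    obtain ⟨α, hα, z, hz, rfl⟩ := hu
    have hexp : (expUnit z).1ᵀ = NormedSpace.exp zᵀ := (Matrix.exp_transpose z).symm
    rw [← leadingMinor_transpose, Matrix.transpose_mul, hexp, ← leadingMinor_transpose k g]
    refine leadingMinor_mul_of_sub_one_mem (exp_sub_one_mem_strictlyLower ?_ fun a b hab => ?_) k _
    · obtain ⟨A, B, rfl⟩ := exists_eq_fromBlocks_of_mem_lieAlg hz.1
      exact ⟨Aᵀ, Bᵀ, by simp [Matrix.fromBlocks_transpose]⟩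
    · rwa [wt_sub_of_mem_rootSpace hz hab]
  | one => simp
  | mul u v _ _ hu hv => rw [Units.val_mul, ← mul_assoc, hv, hu]
  | inv u _ hu => rw [← hu, Units.inv_mul_cancel_right]

theorem coe_torus (c : Fin n → ℂˣ) :
    (torus c).1.1 = Matrix.diagonal fun b => ∏ i, (c i : ℂ) ^ wt b i := by
  have hlist (L : List (Fin n)) : (L.map fun i => coroot i (c i)).prod.1.1 =
      Matrix.diagonal fun b => (L.map fun i => (c i : ℂ) ^ wt b i).prod := by
    induction L with
    | nil => simp
    | cons i L ih =>
      rw [List.map_cons, List.prod_cons, Subgroup.coe_mul, Units.val_mul, ih,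
        coe_coroot_eq_diagonal, Matrix.diagonal_mul_diagonal]
      rfl
  rw [torus, List.ofFn_eq_map, hlist]
  simp only [← List.ofFn_eq_map, List.prod_ofFn]

theorem sum_epsWt_castLE (i : Fin n) {m : ℕ} (hm : m ≤ n) :
    ∑ j : Fin m, epsWt i (Fin.castLE hm j) =
      if i.val + 1 = m then (if m < n then 1 else 2) else 0 := by
  induction m with
  | zero => simp
  | succ m ih =>
    rw [Fin.sum_univ_castSucc]
    simp only [Fin.castLE_castSucc, ih (by omega)]
    simp only [epsWt, Fin.ext_iff, Fin.val_castLE, Fin.val_last]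
    split_ifs <;> omega

theorem prod_zpow_eq_zpow_sum {G ι : Type*} [CommGroup G] (a : G) (s : Finset ι) (f : ι → ℤ) :
    ∏ i ∈ s, a ^ f i = a ^ ∑ i ∈ s, f i :=
  (map_prod (zpowersHom G a) (fun i => .ofAdd (f i)) s).symm

theorem sum_wt_topIdx (k : Fin n) :
    ∑ j, wt (.inl (topIdx k j)) = (if k.val + 1 < n then 1 else 2 : ℤ) • fundWeight k := by
  ext i
  rw [Finset.sum_apply]
  refine (sum_epsWt_castLE i k.2).trans ?_
  simp only [fundWeight, Pi.smul_apply, Pi.single_apply, Fin.ext_iff, smul_eq_mul]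
  split_ifs <;> omega

theorem leadingMinor_torus {k : Fin n} (hk : k.val + 1 < n) (c : Fin n → ℂˣ) :
    leadingMinor k (torus c).1.1 = ∏ i, (c i : ℂ) ^ fundWeight k i := by
  have hdiag : (torus c).1.1.toBlocks₁₁ =
      Matrix.diagonal fun b => ∏ i, (c i : ℂ) ^ wt (.inl b) i := by
    ext a b
    simp [coe_torus, Matrix.toBlocks₁₁, Matrix.diagonal_apply]
  have hsum (i : Fin n) : ∑ j, wt (.inl (topIdx k j)) i = fundWeight k i := by
    simpa [hk] using congrFun (sum_wt_topIdx k) i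
  rw [leadingMinor, hdiag, Matrix.submatrix_diagonal _ _ (topIdx_injective k),
    Matrix.det_diagonal]
  simp only [Function.comp_apply]
  rw [Finset.prod_comm]
  refine Finset.prod_congr rfl fun i _ => ?_
  simp only [← hsum, ← prod_zpow_eq_zpow_sum, ← Units.val_zpow_eq_zpow_val, Units.coe_prod]

theorem isRegular_leadingMinor (k : Fin n) :
    IsRegular fun g : grp n => leadingMinor k g.1.1 := by
  refine ⟨(Matrix.of fun a b =>
    MvPolynomial.X (.inl (topIdx k a), .inl (topIdx k b))).det, fun g => ?_⟩
  rw [RingHom.map_det]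
  refine congrArg Matrix.det (Matrix.ext fun a b => ?_)
  simp [Matrix.toBlocks₁₁]

theorem isPrincipalMinor_leadingMinor {k : Fin n} (hk : k.val + 1 < n) :
    IsPrincipalMinor (fundWeight k) fun g : grp n => leadingMinor k g.1.1 := by
  refine ⟨isRegular_leadingMinor k, fun g c u hu v hv hg => ?_⟩
  change leadingMinor k g.1.1 = _
  rw [hg, Units.val_mul, Units.val_mul, leadingMinor_mul_of_mem_unipPos k hv,
    leadingMinor_mul_of_mem_unipNeg k hu, leadingMinor_torus hk]

end LeadingMinor

section SimpleRoots

theorem cartan_nonpos {i j : Fin n} (h : i ≠ j) : cartan n i j ≤ 0 := by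
  simp only [cartan, h, if_false]
  split_ifs <;> omega

theorem cartan_eq_zero_symm {i j : Fin n} (h : cartan n i j = 0) : cartan n j i = 0 := by
  simp only [cartan, Fin.ext_iff] at h ⊢
  split_ifs at h ⊢ <;> omega

theorem vecWt_vecSwap_eq (m i : Fin n) (b : VecIdx n) :
    vecWt m (vecSwap i b) = vecWt m b - vecWt i b * cartan n m i := by
  have hlt (hi : i.val + 1 < n) (j : Fin n) :
      epsWt m (nodeSwap i j) = epsWt m j - epsWt i j * cartan n m i := by
    rw [nodeSwap_apply hi]
    split_ifs <;> simp only [epsWt, cartan, Fin.ext_iff] <;> split_ifs <;> omega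
  have hlast (hi : ¬i.val + 1 < n) (j : Fin n) :
      (if j = i then -epsWt m j else epsWt m j) = epsWt m j - epsWt i j * cartan n m i := by
    simp only [epsWt, cartan, Fin.ext_iff]
    split_ifs <;> omega
  rcases b with j | u | j
  · rw [vecSwap_inl]
    split_ifs with hi hj
    · exact hlt hi j
    · simpa [vecWt, hj] using hlast hi j
    · simpa [vecWt, hj] using hlast hi j
  · rw [vecSwap_inr_inl]
    simp [vecWt]
  · rw [vecSwap_inr_inr]
    split_ifs with hi hj
    · simp only [vecWt, hlt hi]
      ring
    · simp only [vecWt]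
      linarith [if_pos hj ▸ hlast hi j, congrArg (epsWt m) hj]
    · simp only [vecWt]
      linarith [if_neg hj ▸ hlast hi j]

/-- Twice the coordinate of the weight of a basis vector of `V(Λ_n)` along some `ε_j`. -/
def spinSign (s : Bool) : ℤ := if s then 1 else -1

theorem spinSign_injective : Function.Injective spinSign := by decide

theorem two_mul_spinWt {i : Fin n} (h : i.val + 1 < n) (b : SpinIdx n) :
    2 * spinWt i b = spinSign (b i) - spinSign (b ⟨i.val + 1, h⟩) := by
  simp only [spinWt, h, spinSign, dif_pos]
  split_ifs <;> simp

theorem spinSign_spinSwap (i : Fin n) (b : SpinIdx n) (m : Fin n) :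
    spinSign (spinSwap i b m) =
      spinSign (b m) - spinWt i b * if m = i then 2 else if m.val = i.val + 1 then -2 else 0 := by
  by_cases hi : i.val + 1 < n
  · have hwt := two_mul_spinWt hi b
    simp only [spinSwap, hi, if_true, Function.comp_apply, nodeSwap_apply hi]
    split_ifs with hm hm'
    · subst hm
      omega
    · obtain rfl : m = ⟨i.val + 1, hi⟩ := Fin.ext hm'
      omega
    · ring
  · have hm' : m.val ≠ i.val + 1 := by omega
    by_cases hm : m = i
    · subst hm
      cases hb : b m <;> simp [spinSwap, spinWt, spinSign, hi, hb]
    · simp [spinSwap, hi, hm, hm']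

theorem spinWt_spinSwap_eq (m i : Fin n) (b : SpinIdx n) :
    spinWt m (spinSwap i b) = spinWt m b - spinWt i b * cartan n m i := by
  by_cases hm : m.val + 1 < n
  · have hb := two_mul_spinWt hm b
    have hswap := two_mul_spinWt hm (spinSwap i b)
    rw [spinSign_spinSwap, spinSign_spinSwap] at hswap
    simp only [Fin.ext_iff] at hswap
    simp only [cartan, Fin.ext_iff]
    split_ifs at hswap ⊢ <;> omega
  · have hlast (b : SpinIdx n) : spinWt m b = spinSign (b m) := by simp [spinWt, hm, spinSign]
    rw [hlast, hlast, spinSign_spinSwap]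
    simp only [cartan, Fin.ext_iff]
    split_ifs <;> omega

theorem spinSwap_comm {i j : Fin n} (h : cartan n i j = 0) (b : SpinIdx n) :
    spinSwap i (spinSwap j b) = spinSwap j (spinSwap i b) := by
  ext m
  apply spinSign_injective
  simp only [spinSign_spinSwap, spinWt_spinSwap_eq, h, cartan_eq_zero_symm h]
  ring

theorem commute_spinE_spinF {i j : Fin n} (h : i ≠ j) : Commute (spinE i) (spinF j) := by
  have hmem (i : Fin n) (b : SpinIdx n) : -1 ≤ spinWt i b ∧ spinWt i b ≤ 1 := by
    unfold spinWt
    split_ifs <;> simp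
  ext a b
  rw [spinE_eq_raise, spinF_eq_lower, mul_lower_apply, mul_raise_apply]
  simp only [raise, lower, Matrix.of_apply, ← ite_and]
  have hi := hmem i b
  have hj := hmem j b
  have hcartan := cartan_nonpos h
  have hcartan' := cartan_nonpos h.symm
  by_cases hb : spinWt j b = 1 ∧ spinWt i b = -1 ∧ cartan n i j = 0
  · obtain ⟨hbj, hbi, h0⟩ := hb
    simp [spinWt_spinSwap_eq, hbj, hbi, h0, cartan_eq_zero_symm h0, spinSwap_comm h0]
  · rw [if_neg, if_neg]
    · rintro ⟨hbi, hbj, -⟩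
      rw [spinWt_spinSwap_eq, hbi] at hbj
      exact hb ⟨by omega, hbi, cartan_eq_zero_symm (by omega)⟩
    · rintro ⟨hbj, hbi, -⟩
      rw [spinWt_spinSwap_eq, hbj] at hbi
      exact hb ⟨hbj, by omega, by omega⟩

theorem vecE_mul_vecF {i j : Fin n} (h : i ≠ j) : vecE i * vecF j = 0 := by
  ext a b
  rw [Matrix.mul_apply]
  refine Finset.sum_eq_zero fun c _ => ?_
  rw [Fin.ne_iff_vne] at h
  rcases a with a | a | a <;> rcases c with c | c | c <;> rcases b with b | b | b <;>
    simp [vecE, vecF, Fin.ext_iff] <;> omega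

theorem vecF_mul_vecE {i j : Fin n} (h : i ≠ j) : vecF j * vecE i = 0 := by
  ext a b
  rw [Matrix.mul_apply]
  refine Finset.sum_eq_zero fun c _ => ?_
  rw [Fin.ne_iff_vne] at h
  rcases a with a | a | a <;> rcases c with c | c | c <;> rcases b with b | b | b <;>
    simp [vecE, vecF, Fin.ext_iff] <;> omega

theorem commute_genE_genF {i j : Fin n} (h : i ≠ j) : Commute (genE i) (genF j) := by
  rw [Commute, SemiconjBy, genE, genF, Matrix.fromBlocks_multiply, Matrix.fromBlocks_multiply]
  simp [vecE_mul_vecF h, vecF_mul_vecE h, (commute_spinE_spinF h).eq]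

theorem wt_of_genE_ne_zero {i : Fin n} {a b : Idx n} (h : genE i a b ≠ 0) :
    wt a = wt b + simpleRoot i := by
  rcases a with a | a <;> rcases b with b | b
  · by_cases hi : i.val + 1 < n
    · have hab : vecE i a b ≠ 0 := h
      rw [vecE_eq_raise hi] at hab
      simp only [raise, Matrix.of_apply, ne_eq, ite_eq_right_iff, one_ne_zero, imp_false,
        not_not] at hab
      obtain ⟨hb, rfl⟩ := hab
      ext m
      simp [wt, vecWt_vecSwap_eq, hb, simpleRoot]
    · have hn : i.val + 1 = n := by omega
      rw [simpleRoot_eq_wt hn]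
      ext m
      rcases a with a | a | a <;> rcases b with b | b | b <;>
        simp_all [genE, vecE, wt, vecWt] <;> omega
  · exact absurd rfl h
  · exact absurd rfl h
  · have hab : spinE i a b ≠ 0 := h
    rw [spinE_eq_raise] at hab
    simp only [raise, Matrix.of_apply, ne_eq, ite_eq_right_iff, one_ne_zero, imp_false,
      not_not] at hab
    obtain ⟨hb, rfl⟩ := hab
    ext m
    simp [wt, spinWt_spinSwap_eq, hb, simpleRoot]

theorem genF_eq_zero_of_genE_eq_zero {i : Fin n} {a b : Idx n} (h : genE i b a = 0) :
    genF i a b = 0 := by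
  rcases a with a | a <;> rcases b with b | b
  · change vecE i b a = 0 at h
    change vecF i a b = 0
    rcases b with j | u | j <;> rcases a with k | u' | k <;> simp_all [vecE, vecF] <;> tauto
  · rfl
  · rfl
  · change spinE i b a = 0 at h
    change spinF i a b = 0
    rw [spinE_eq_raise] at h
    rw [spinF_eq_lower]
    simp only [raise, lower, Matrix.of_apply, ite_eq_right_iff, one_ne_zero, imp_false,
      not_and] at h ⊢
    rintro hb rfl
    exact h (by rw [spinWt_spinSwap, hb]) (spinSwap_involutive i b).symm

theorem wt_of_genF_ne_zero {i : Fin n} {a b : Idx n} (h : genF i a b ≠ 0) :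
    wt a = wt b - simpleRoot i := by
  rw [wt_of_genE_ne_zero (mt genF_eq_zero_of_genE_eq_zero h), add_sub_cancel_right]

end SimpleRoots

section RootSubgroups

attribute [local instance] LieRing.ofAssociativeRing

theorem mem_rootSpace {α : Weight n} {z : Matrix (Idx n) (Idx n) ℂ} (hz : z ∈ lieAlg n)
    (h : ∀ a b, z a b ≠ 0 → wt a - wt b = α) : z ∈ rootSpace α := by
  refine ⟨hz, fun i => Matrix.ext fun a b => ?_⟩
  rw [genH_eq_diagonal, LieRing.of_associative_ring_bracket, Matrix.sub_apply,
    Matrix.diagonal_mul, Matrix.mul_diagonal, mul_comm (z a b), ← sub_mul, Matrix.smul_apply,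
    smul_eq_mul]
  by_cases hab : z a b = 0
  · simp [hab]
  · simp [← h a b hab]

theorem genE_mem_rootSpace (i : Fin n) : genE i ∈ rootSpace (simpleRoot i) :=
  mem_rootSpace (LieSubalgebra.subset_lieSpan (.inl ⟨i, rfl⟩)) fun _ _ hab =>
    sub_eq_of_eq_add' (wt_of_genE_ne_zero hab)

theorem genF_mem_rootSpace (i : Fin n) : genF i ∈ rootSpace (-simpleRoot i) :=
  mem_rootSpace (LieSubalgebra.subset_lieSpan (.inr ⟨i, rfl⟩)) fun _ _ hab => by
    rw [wt_of_genF_ne_zero hab, sub_sub_cancel_left]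

theorem smul_mem_rootSpace {α : Weight n} (t : ℂ) {z : Matrix (Idx n) (Idx n) ℂ}
    (hz : z ∈ rootSpace α) : t • z ∈ rootSpace α :=
  mem_rootSpace ((lieAlg n).smul_mem t hz.1) fun _ _ hab =>
    wt_sub_of_mem_rootSpace hz (right_ne_zero_of_mul hab)

theorem isPositive_simpleRoot (i : Fin n) : IsPositive (simpleRoot i) := by
  refine ⟨fun h => ?_, Pi.single i 1, ?_⟩
  · simpa [h] using rhoPairing_simpleRoot i
  · rw [Finset.sum_eq_single i (fun j _ hj => by simp [hj]) (by simp)]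
    simp

theorem x_mem_unipPos (i : Fin n) (t : ℂ) : (x i t).1 ∈ unipPos n :=
  Subgroup.subset_closure ⟨_, isPositive_simpleRoot i, _,
    smul_mem_rootSpace t (genE_mem_rootSpace i), rfl⟩

theorem y_mem_unipNeg (i : Fin n) (t : ℂ) : (y i t).1 ∈ unipNeg n :=
  Subgroup.subset_closure ⟨_, isPositive_simpleRoot i, _,
    smul_mem_rootSpace t (genF_mem_rootSpace i), rfl⟩

theorem commute_x_y {i j : Fin n} (h : i ≠ j) (s t : ℂ) : Commute (x i s) (y j t) := by
  have hcomm : Commute (s • genE i) (t • genF j) :=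
    ((commute_genE_genF h).smul_left s).smul_right t
  exact Subtype.ext (Units.ext hcomm.exp)

theorem coroot_inv (i : Fin n) (c : ℂˣ) : (coroot i c)⁻¹ = coroot i c⁻¹ := by
  refine inv_eq_of_mul_eq_one_right (Subtype.ext (Units.ext ?_))
  simp only [Subgroup.coe_mul, Units.val_mul, coe_coroot, ← map_mul]
  simp [Matrix.one_fin_two.symm]

theorem conj_coroot_expUnit {α : Weight n} {z : Matrix (Idx n) (Idx n) ℂ}
    (hz : z ∈ rootSpace α) (i : Fin n) (c : ℂˣ) :
    (coroot i c).1 * expUnit z * (coroot i c).1⁻¹ = expUnit ((c : ℂ) ^ α i • z) := by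
  have hconj : (coroot i c).1.1 * z * (coroot i c).1⁻¹.1 = (c : ℂ) ^ α i • z := by
    rw [Units.mul_inv_eq_iff_eq_mul, coe_coroot_eq_diagonal]
    ext a b
    rw [Matrix.diagonal_mul, Matrix.mul_diagonal, Matrix.smul_apply, smul_eq_mul]
    by_cases hab : z a b = 0
    · simp [hab]
    · rw [← wt_sub_of_mem_rootSpace hz hab, Pi.sub_apply, zpow_sub₀ c.ne_zero]
      field_simp
  exact Units.ext ((Matrix.exp_units_conj _ _).symm.trans (congrArg _ hconj))

theorem coroot_mul_y (i j : Fin n) (c : ℂˣ) (t : ℂ) :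
    coroot i c * y j t = y j ((c : ℂ) ^ (-cartan n i j) * t) * coroot i c := by
  rw [← mul_inv_eq_iff_eq_mul]
  refine Subtype.ext ((conj_coroot_expUnit (smul_mem_rootSpace t (genF_mem_rootSpace j)) i c).trans
    (congrArg expUnit ?_))
  rw [smul_smul]
  rfl

theorem conj_coroot_mem_unipPos (i : Fin n) (c : ℂˣ) {v : Ambient n} (hv : v ∈ unipPos n) :
    (coroot i c).1 * v * (coroot i c).1⁻¹ ∈ unipPos n := by
  suffices h : unipPos n ≤ (unipPos n).comap (MulAut.conj (coroot i c).1).toMonoidHom from h hv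
  refine (Subgroup.closure_le _).2 ?_
  rintro _ ⟨α, hα, z, hz, rfl⟩
  refine Subgroup.subset_closure ⟨α, hα, _, smul_mem_rootSpace ((c : ℂ) ^ α i) hz, ?_⟩
  exact conj_coroot_expUnit hz i c

end RootSubgroups

section BigCell

open Filter Topology

variable (n) in
/-- The submonoid of `G` generated by the `y_i(t)`. -/
noncomputable def lowerMonoid : Submonoid (grp n) :=
  Submonoid.closure (Set.range fun p : Fin n × ℂ => y p.1 p.2)

variable (n) in
/-- The submonoid of `G` generated by the `x_i(t)` and the `α_i^∨(c)`. -/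
noncomputable def upperMonoid : Submonoid (grp n) :=
  Submonoid.closure ((Set.range fun p : Fin n × ℂ => x p.1 p.2) ∪
    Set.range fun p : Fin n × ℂˣ => coroot p.1 p.2)

theorem y_mem_lowerMonoid (i : Fin n) (t : ℂ) : y i t ∈ lowerMonoid n :=
  Submonoid.subset_closure ⟨(i, t), rfl⟩

theorem x_mem_upperMonoid (i : Fin n) (t : ℂ) : x i t ∈ upperMonoid n :=
  Submonoid.subset_closure (.inl ⟨(i, t), rfl⟩)

theorem coroot_mem_upperMonoid (i : Fin n) (c : ℂˣ) : coroot i c ∈ upperMonoid n :=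
  Submonoid.subset_closure (.inr ⟨(i, c), rfl⟩)

theorem coe_mem_unipNeg {a : grp n} (ha : a ∈ lowerMonoid n) : a.1 ∈ unipNeg n := by
  induction ha using Submonoid.closure_induction with
  | mem _ h =>
    obtain ⟨⟨i, t⟩, rfl⟩ := h
    exact y_mem_unipNeg i t
  | one => exact one_mem _
  | mul _ _ _ _ ha hb => exact mul_mem ha hb

theorem torus_mul_coroot (c : Fin n → ℂˣ) (i : Fin n) (d : ℂˣ) :
    torus c * coroot i d = torus (c * Pi.mulSingle i d) := by
  refine Subtype.ext (Units.ext ?_)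
  rw [Subgroup.coe_mul, Units.val_mul, coe_torus, coe_torus, coe_coroot_eq_diagonal,
    Matrix.diagonal_mul_diagonal]
  congr 1
  ext b
  simp only [Pi.mul_apply, Units.val_mul, mul_zpow, Finset.prod_mul_distrib]
  congr 1
  rw [Finset.prod_eq_single i (fun j _ hj => by simp [hj]) (by simp), Pi.mulSingle_eq_same]

theorem exists_eq_torus_mul {b : grp n} (hb : b ∈ upperMonoid n) :
    ∃ c, ∃ v ∈ unipPos n, b.1 = (torus c).1 * v := by
  induction hb using Submonoid.closure_induction_right with
  | one => exact ⟨1, 1, one_mem _, Units.ext (by simp [coe_torus])⟩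
  | mul_right b _ z hz ih =>
    obtain ⟨c, v, hv, hb⟩ := ih
    obtain ⟨⟨i, t⟩, rfl⟩ | ⟨⟨i, d⟩, rfl⟩ := hz
    · exact ⟨c, v * (x i t).1, mul_mem hv (x_mem_unipPos i t), by
        rw [Subgroup.coe_mul, hb, mul_assoc]⟩
    · have hconj := conj_coroot_mem_unipPos i d⁻¹ hv
      refine ⟨c * Pi.mulSingle i d, _, hconj, ?_⟩
      rw [← coroot_inv, ← torus_mul_coroot, Subgroup.coe_mul, Subgroup.coe_mul, hb]
      simp [mul_assoc]

theorem eventually_mul_y_eq (i : Fin n) {b : grp n} (hb : b ∈ upperMonoid n) :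
    ∃ r : ℂ → ℂ, Tendsto r (𝓝 0) (𝓝 0) ∧
      ∀ᶠ s in 𝓝 0, ∃ b' ∈ upperMonoid n, b * y i s = y i (r s) * b' := by
  induction hb using Submonoid.closure_induction with
  | mem b hb =>
    obtain ⟨⟨j, t⟩, rfl⟩ | ⟨⟨j, c⟩, rfl⟩ := hb
    · by_cases hij : j = i
      · subst hij
        have hcont : ContinuousAt (fun s : ℂ => 1 + t * s) 0 := by fun_prop
        have hne : ∀ᶠ s in 𝓝 (0 : ℂ), 1 + t * s ≠ 0 := hcont.eventually_ne (by simp)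
        refine ⟨fun s => s / (1 + t * s), ?_, hne.mono fun s hs => ?_⟩
        · have : ContinuousAt (fun s : ℂ => s / (1 + t * s)) 0 :=
            continuousAt_id.div hcont (by simp)
          simpa [ContinuousAt] using this
        · exact ⟨_, mul_mem (coroot_mem_upperMonoid j (Units.mk0 _ hs)) (x_mem_upperMonoid j _),
            by rw [← mul_assoc]; exact x_mul_y j t s (Units.mk0 _ hs) rfl⟩
      · exact ⟨id, tendsto_id, .of_forall fun s => ⟨_, x_mem_upperMonoid j t, commute_x_y hij t s⟩⟩
    · refine ⟨fun s => (c : ℂ) ^ (-cartan n j i) * s, ?_, .of_forall fun s =>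
        ⟨_, coroot_mem_upperMonoid j c, coroot_mul_y j i c s⟩⟩
      simpa using (continuous_const_mul ((c : ℂ) ^ (-cartan n j i))).tendsto 0
  | one => exact ⟨id, tendsto_id, .of_forall fun s => ⟨1, one_mem _, by simp⟩⟩
  | mul b b' _ _ ihb ihb' =>
    obtain ⟨r, hr, hb⟩ := ihb
    obtain ⟨r', hr', hb'⟩ := ihb'
    refine ⟨r ∘ r', hr.comp hr', (hb'.and (hr'.eventually hb)).mono fun s hs => ?_⟩
    obtain ⟨⟨d, hd, hbs'⟩, e, he, hbs⟩ := hs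
    exact ⟨e * d, mul_mem he hd, by
      rw [mul_assoc, hbs', ← mul_assoc, hbs, mul_assoc, Function.comp_apply]⟩

theorem IsRegular.sub {f f' : grp n → ℂ} (hf : IsRegular f) (hf' : IsRegular f') :
    IsRegular (f - f') := by
  obtain ⟨p, hp⟩ := hf
  obtain ⟨p', hp'⟩ := hf'
  exact ⟨p - p', fun g => by simp [hp, hp']⟩

theorem IsRegular.comp_mul_right {f : grp n → ℂ} (hf : IsRegular f) (h : grp n) :
    IsRegular fun g => f (g * h) := by
  obtain ⟨p, hp⟩ := hf
  refine ⟨MvPolynomial.bind₁ (fun ab => ∑ e, MvPolynomial.X (ab.1, e) *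
    MvPolynomial.C (h.1.1 e ab.2)) p, fun g => ?_⟩
  refine (hp (g * h)).trans (Eq.trans ?_ (MvPolynomial.eval₂Hom_bind₁ _ _ _ p).symm)
  refine congrArg (fun v => MvPolynomial.eval v p) (funext fun ab => ?_)
  simp [Matrix.mul_apply]

section

attribute [local instance] Matrix.linftyOpNormedRing Matrix.linftyOpNormedAlgebra

theorem IsRegular.analyticOnNhd_comp_y {f : grp n → ℂ} (hf : IsRegular f) (g : grp n)
    (i : Fin n) : AnalyticOnNhd ℂ (fun s => f (g * y i s)) Set.univ := by
  have hentry (a b : Idx n) : Differentiable ℂ fun s => (g * y i s).1.1 a b := by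
    have hexp : Differentiable ℂ fun s : ℂ => NormedSpace.exp (s • genF i) := fun s =>
      (hasDerivAt_exp_smul_const (genF i) s).differentiableAt
    have hmul : Differentiable ℂ fun s : ℂ => g.1.1 * NormedSpace.exp (s • genF i) :=
      (differentiable_const _).mul hexp
    exact differentiable_pi.1 (differentiable_pi.1 hmul a) b
  obtain ⟨p, hp⟩ := hf
  simp only [hp]
  exact AnalyticOnNhd.aeval_mvPolynomial (fun ab s _ => (hentry ab.1 ab.2).analyticAt s) p

end

theorem IsRegular.eq_zero {f : grp n → ℂ} (hf : IsRegular f)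
    (h : ∀ a ∈ lowerMonoid n, ∀ b ∈ upperMonoid n, f (a * b) = 0) (g : grp n) : f g = 0 := by
  induction g using grp_induction generalizing f with
  | one => simpa using h 1 (one_mem _) 1 (one_mem _)
  | mul_x _ i t ih =>
    refine ih (hf.comp_mul_right _) fun a ha b hb => ?_
    rw [mul_assoc]
    exact h a ha _ (mul_mem hb (x_mem_upperMonoid i t))
  | mul_y _ i t ih =>
    refine ih (hf.comp_mul_right _) fun a ha b hb => ?_
    obtain ⟨r, -, hr⟩ := eventually_mul_y_eq i hb
    have hzero : ∀ᶠ s in 𝓝 0, f (a * b * y i s) = 0 := by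
      filter_upwards [hr] with s ⟨b', hb', hs⟩
      rw [mul_assoc, hs, ← mul_assoc]
      exact h _ (mul_mem ha (y_mem_lowerMonoid i _)) b' hb'
    exact congrFun ((hf.analyticOnNhd_comp_y (a * b) i).eq_of_eventuallyEq
      (g := 0) analyticOnNhd_const hzero) t

theorem IsPrincipalMinor.unique {μ : Weight n} {D D' : grp n → ℂ} (hD : IsPrincipalMinor μ D)
    (hD' : IsPrincipalMinor μ D') : D = D' := by
  ext g
  refine sub_eq_zero.1 ((hD.1.sub hD'.1).eq_zero (fun a ha b hb => sub_eq_zero.2 ?_) g)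
  obtain ⟨c, v, hv, hbv⟩ := exists_eq_torus_mul hb
  have hab : (a * b).1 = a.1 * (torus c).1 * v := by rw [Subgroup.coe_mul, hbv, mul_assoc]
  rw [hD.2 _ c _ (coe_mem_unipNeg ha) v hv hab, hD'.2 _ c _ (coe_mem_unipNeg ha) v hv hab]

theorem principalMinor_fundWeight {k : Fin n} (hk : k.val + 1 < n) (g : grp n) :
    principalMinor (fundWeight k) g = leadingMinor k g.1.1 := by
  have hex : ∃ D : grp n → ℂ, IsPrincipalMinor (fundWeight k) D :=
    ⟨_, isPrincipalMinor_leadingMinor hk⟩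
  rw [principalMinor, dif_pos hex]
  exact congrFun (hex.choose_spec.unique (isPrincipalMinor_leadingMinor hk)) g

theorem exists_genMinor_eq {k : Fin n} (hk : k.val + 1 < n) (u v : weylGroup n) (g : grp n) :
    ∃ u' v' : weylGroup n, u'.1 (fundWeight k) = u.1 (fundWeight k) ∧
      v'.1 (fundWeight k) = v.1 (fundWeight k) ∧
      genMinor (fundWeight k) (u.1 (fundWeight k)) (v.1 (fundWeight k)) g =
        leadingMinor k ((lift u')⁻¹ * g * lift v').1.1 := by
  have h : (∃ u' : weylGroup n, u'.1 (fundWeight k) = u.1 (fundWeight k)) ∧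
      ∃ v' : weylGroup n, v'.1 (fundWeight k) = v.1 (fundWeight k) := ⟨⟨u, rfl⟩, v, rfl⟩
  refine ⟨h.1.choose, h.2.choose, h.1.choose_spec, h.2.choose_spec, ?_⟩
  rw [genMinor, dif_pos h, principalMinor_fundWeight hk]

end BigCell

section WeylPermutations

/-- The involution `v_j ↔ v_{j̄}` of the basis of `V(Λ_1)`, which negates weights. -/
def bar : VecIdx n → VecIdx n
  | .inl j => .inr (.inr j)
  | .inr (.inl u) => .inr (.inl u)
  | .inr (.inr j) => .inl j

theorem height_bar (b : VecIdx n) : height (bar b) = -height b := by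
  rcases b with j | u | j <;> simp [bar, height]

theorem vecWt_bar (i : Fin n) (b : VecIdx n) : vecWt i (bar b) = -vecWt i b := by
  rcases b with j | u | j <;> simp [bar, vecWt]

theorem coe_simple_apply (i : Fin n) (μ : Weight n) :
    (simple i).1 μ = μ - μ i • simpleRoot i :=
  Module.reflection_apply μ (proj_simpleRoot i)

theorem wt_vecSwap (i : Fin n) (b : VecIdx n) :
    wt (.inl (vecSwap i b)) = (simple i).1 (wt (.inl b)) := by
  rw [coe_simple_apply]
  exact funext fun m => vecWt_vecSwap_eq m i b

theorem height_vecSwap (i : Fin n) (b : VecIdx n) :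
    height (vecSwap i b) = height b - vecWt i b := by
  have h := congrArg rhoPairing (wt_vecSwap i b)
  rw [coe_simple_apply, map_sub, map_smul, rhoPairing_wt, rhoPairing_wt, rhoPairing_simpleRoot,
    show wt (.inl b) i = vecWt i b from rfl, smul_eq_mul] at h
  omega

theorem vecSwap_eq_self_iff {i : Fin n} {b : VecIdx n} : vecSwap i b = b ↔ vecWt i b = 0 := by
  rw [← height_injective.eq_iff, height_vecSwap, sub_eq_self]

theorem vecSwap_bar (i : Fin n) (b : VecIdx n) : vecSwap i (bar b) = bar (vecSwap i b) := by
  apply height_injective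
  rw [height_vecSwap, height_bar, height_bar, height_vecSwap, vecWt_bar]
  ring

theorem wt_inl_injective : Function.Injective fun b : VecIdx n => wt (.inl b) := by
  intro b c h
  have := congrArg rhoPairing h
  simp only [rhoPairing_wt] at this
  exact height_injective (by omega)

theorem exists_perm_wt_eq (w : weylGroup n) :
    ∃ π : Equiv.Perm (VecIdx n), ∀ b, wt (.inl (π b)) = w.1 (wt (.inl b)) := by
  obtain ⟨ω, rfl⟩ := exists_wordProd w
  induction ω with
  | nil => exact ⟨1, fun _ => rfl⟩
  | cons i ω ih =>
    obtain ⟨π, hπ⟩ := ih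
    exact ⟨vecSwap i * π, fun b => by
      rw [Equiv.Perm.mul_apply, wt_vecSwap, hπ]
      simp [wordProd]⟩

variable (n) in
/-- The action of the Weyl group on the weights of `V(Λ_1)`. -/
noncomputable def vecPerm : weylGroup n →* Equiv.Perm (VecIdx n) where
  toFun w := (exists_perm_wt_eq w).choose
  map_one' := Equiv.ext fun b => wt_inl_injective ((exists_perm_wt_eq 1).choose_spec b)
  map_mul' u v := Equiv.ext fun b => wt_inl_injective <| by
    simp only [Equiv.Perm.mul_apply, (exists_perm_wt_eq _).choose_spec]
    rfl

theorem wt_vecPerm (w : weylGroup n) (b : VecIdx n) :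
    wt (.inl (vecPerm n w b)) = w.1 (wt (.inl b)) :=
  (exists_perm_wt_eq w).choose_spec b

theorem vecPerm_simple (i : Fin n) : vecPerm n (simple i) = vecSwap i :=
  Equiv.ext fun b => wt_inl_injective ((wt_vecPerm _ b).trans (wt_vecSwap i b).symm)

theorem vecPerm_injective : Function.Injective (vecPerm n) := by
  intro u v huv
  have hwt (b : VecIdx n) : u.1 (wt (.inl b)) = v.1 (wt (.inl b)) := by
    rw [← wt_vecPerm, huv, wt_vecPerm]
  have hfund (k : Fin n) : u.1 (fundWeight k) = v.1 (fundWeight k) := by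
    have hne : (if k.val + 1 < n then 1 else 2 : ℤ) ≠ 0 := by split_ifs <;> decide
    refine smul_right_injective _ hne ?_
    simp only [← map_smul, ← sum_wt_topIdx, map_sum, hwt]
  exact Subtype.ext (LinearEquiv.toLinearMap_injective
    (LinearMap.pi_ext' fun k => LinearMap.ext_ring (hfund k)))

theorem vecPerm_bar (w : weylGroup n) (b : VecIdx n) :
    vecPerm n w (bar b) = bar (vecPerm n w b) := by
  have hneg (b : VecIdx n) : wt (.inl (bar b)) = -wt (.inl b) := funext fun i => vecWt_bar i b
  exact wt_inl_injective (by simp only [wt_vecPerm, hneg, map_neg])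

end WeylPermutations

section Stabilizer

theorem mem_range_topIdx {k : Fin n} {b : VecIdx n} :
    b ∈ Set.range (topIdx k) ↔ n - k ≤ height b := by
  constructor
  · rintro ⟨j, rfl⟩
    simp only [topIdx, height, Fin.val_castLE]
    omega
  · intro h
    rcases b with j | u | j <;> simp only [height] at h
    · exact ⟨⟨j, by omega⟩, rfl⟩
    · omega
    · omega

theorem sum_height_vecPerm_topIdx {w : weylGroup n} {k : Fin n}
    (hw : w.1 (fundWeight k) = fundWeight k) :
    ∑ j, height (vecPerm n w (topIdx k j)) = ∑ j, height (topIdx k j) := by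
  have hsum : ∑ j, wt (.inl (vecPerm n w (topIdx k j))) = ∑ j, wt (.inl (topIdx k j)) := by
    simp only [wt_vecPerm, ← map_sum, sum_wt_topIdx, map_smul, hw]
  have h := congrArg rhoPairing hsum
  simp only [map_sum, rhoPairing_wt, ← Finset.mul_sum] at h
  omega

theorem range_topIdx_subset_image {w : weylGroup n} {k : Fin n}
    (hw : w.1 (fundWeight k) = fundWeight k) :
    Set.range (topIdx k) ⊆ vecPerm n w '' Set.range (topIdx k) := by
  intro b hb
  by_contra hbw
  let excess (b : VecIdx n) : ℤ := height b - (n - k - 1)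
  have hlt : ∑ j, max (excess (vecPerm n w (topIdx k j))) 0 < ∑ a, max (excess a) 0 := by
    refine (Finset.sum_map Finset.univ ⟨_, (vecPerm n w).injective.comp (topIdx_injective k)⟩
      fun a => max (excess a) 0).symm.trans_lt (Finset.sum_lt_sum_of_subset
        (Finset.subset_univ _) (Finset.mem_univ b) (fun h => hbw ?_) ?_
        fun _ _ _ => le_max_right _ _)
    · obtain ⟨j, -, hj⟩ := Finset.mem_map.1 h
      exact ⟨_, ⟨j, rfl⟩, hj⟩
    · have := mem_range_topIdx.1 hb
      exact lt_max_of_lt_left (by simp only [excess]; omega)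
  have htop : ∑ a, max (excess a) 0 = ∑ j, excess (topIdx k j) := by
    refine (Finset.sum_of_injOn (topIdx k) (topIdx_injective k).injOn (by simp) ?_ ?_).symm
    · intro a _ ha
      have := mt mem_range_topIdx.2 (by simpa using ha : a ∉ Set.range (topIdx k))
      exact max_eq_right (by simp only [excess]; omega)
    · intro j _
      have := mem_range_topIdx.1 ⟨j, rfl⟩
      exact (max_eq_left (by simp only [excess]; omega)).symm
  refine hlt.not_ge (htop.trans_le ?_)
  calc ∑ j, excess (topIdx k j) = ∑ j, excess (vecPerm n w (topIdx k j)) := by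
        simp only [excess, Finset.sum_sub_distrib, sum_height_vecPerm_topIdx hw]
    _ ≤ _ := Finset.sum_le_sum fun j _ => le_max_left _ _

theorem image_range_topIdx_congr {u v : weylGroup n} {k : Fin n}
    (huv : u.1 (fundWeight k) = v.1 (fundWeight k)) :
    vecPerm n u '' Set.range (topIdx k) = vecPerm n v '' Set.range (topIdx k) := by
  have hsub {u v : weylGroup n} (huv : u.1 (fundWeight k) = v.1 (fundWeight k)) :
      vecPerm n u '' Set.range (topIdx k) ⊆ vecPerm n v '' Set.range (topIdx k) := by
    rintro _ ⟨b, hb, rfl⟩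
    have hstab : (u⁻¹ * v).1 (fundWeight k) = fundWeight k := by
      change u.1.symm (v.1 _) = _
      rw [← huv, LinearEquiv.symm_apply_apply]
    obtain ⟨a, ha, rfl⟩ := range_topIdx_subset_image hstab hb
    exact ⟨a, ha, by simp⟩
  exact (hsub huv).antisymm (hsub huv.symm)

end Stabilizer

section Exchange

theorem wordProd_cons (i : Fin n) (ω : List (Fin n)) :
    wordProd (i :: ω) = simple i * wordProd ω := by
  rw [wordProd, List.map_cons, List.prod_cons, wordProd]

theorem length_wordProd_le (ω : List (Fin n)) : length (wordProd ω) ≤ ω.length :=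
  Nat.sInf_le ⟨ω, rfl, rfl⟩

/-- `t` acts on the weights of `V(Λ_1)` as the reflection which interchanges `b` and `c`. -/
structure Interchanges (t : weylGroup n) (b c : VecIdx n) : Prop where
  apply_left : vecPerm n t b = c
  apply_right : vecPerm n t c = b
  mem_of_ne : ∀ a, vecPerm n t a ≠ a → a = b ∨ a = c ∨ a = bar b ∨ a = bar c

theorem Interchanges.unique {t t' : weylGroup n} {b c : VecIdx n} (h : Interchanges t b c)
    (h' : Interchanges t' b c) : t = t' := by
  refine vecPerm_injective (Equiv.ext fun a => ?_)
  by_cases ha : a = b ∨ a = c ∨ a = bar b ∨ a = bar c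
  · rcases ha with rfl | rfl | rfl | rfl <;>
      simp only [vecPerm_bar, h.apply_left, h'.apply_left, h.apply_right, h'.apply_right]
  · rw [not_not.1 (mt (h.mem_of_ne a) ha), not_not.1 (mt (h'.mem_of_ne a) ha)]

theorem interchanges_simple {i : Fin n} {b : VecIdx n} (hb : vecWt i b ≠ 0) :
    Interchanges (simple i) b (vecSwap i b) := by
  refine ⟨by rw [vecPerm_simple], by rw [vecPerm_simple, vecSwap_involutive], fun a ha => ?_⟩
  rw [vecPerm_simple, ne_eq, vecSwap_eq_self_iff] at ha
  simp only [← height_injective.eq_iff, height_bar, height_vecSwap]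
  rcases a with j | u | j <;> rcases b with k | u' | k <;>
    simp only [vecWt, epsWt, Fin.ext_iff, height, ne_eq, not_true_eq_false] at ha hb ⊢
  all_goals split_ifs at ha hb ⊢ <;> omega

theorem Interchanges.conj {t : weylGroup n} {b c : VecIdx n} (h : Interchanges t b c)
    (i : Fin n) : Interchanges (simple i * t * simple i) (vecSwap i b) (vecSwap i c) := by
  have hperm (a : VecIdx n) : vecPerm n (simple i * t * simple i) a =
      vecSwap i (vecPerm n t (vecSwap i a)) := by
    simp [vecPerm_simple]
  refine ⟨?_, ?_, fun a ha => ?_⟩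
  · rw [hperm, vecSwap_involutive, h.apply_left]
  · rw [hperm, vecSwap_involutive, h.apply_right]
  · have hmem := h.mem_of_ne (vecSwap i a) fun hfix =>
      ha (by rw [hperm, hfix, vecSwap_involutive])
    simp only [← vecSwap_bar]
    exact hmem.imp (vecSwap_involutive i).eq_iff.1 <| .imp (vecSwap_involutive i).eq_iff.1 <|
      .imp (vecSwap_involutive i).eq_iff.1 (vecSwap_involutive i).eq_iff.1

theorem eq_vecSwap_of_height_lt {i : Fin n} {b c : VecIdx n} (hb : height b ≠ 0)
    (hc : height c ≠ 0) (hbc : height c < height b)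
    (hlt : height (vecSwap i b) < height (vecSwap i c)) : c = vecSwap i b := by
  apply height_injective
  simp only [height_vecSwap] at hlt ⊢
  rcases b with j | u | j <;> rcases c with k | u' | k <;>
    simp only [vecWt, epsWt, Fin.ext_iff, height, ne_eq, not_true_eq_false] at *
  all_goals split_ifs at * <;> omega

theorem height_vecSwap_ne_zero {i : Fin n} {b : VecIdx n} (hb : height b ≠ 0) :
    height (vecSwap i b) ≠ 0 := by
  intro h
  have hbar : bar (vecSwap i b) = vecSwap i b := height_injective (by rw [height_bar, h, neg_zero])
  rw [← vecSwap_bar] at hbar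
  have := congrArg height ((vecSwap i).injective hbar)
  rw [height_bar] at this
  omega

theorem exchange {t : weylGroup n} {b c : VecIdx n} (ht : Interchanges t b c)
    (hb : height b ≠ 0) (hc : height c ≠ 0) (hbc : height c < height b) (ω : List (Fin n))
    (hω : height ((vecPerm n (wordProd ω))⁻¹ b) < height ((vecPerm n (wordProd ω))⁻¹ c)) :
    ∃ ω' : List (Fin n), wordProd ω' = t * wordProd ω ∧ ω'.length < ω.length := by
  induction ω generalizing t b c with
  | nil =>
    rw [wordProd, List.map_nil, List.prod_nil, map_one, inv_one] at hω
    exact absurd hω hbc.not_gt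
  | cons i ω ih =>
    have hinv (a : VecIdx n) : (vecPerm n (wordProd (i :: ω)))⁻¹ a =
        (vecPerm n (wordProd ω))⁻¹ (vecSwap i a) := by
      rw [wordProd_cons, map_mul, mul_inv_rev, vecPerm_simple, Equiv.Perm.mul_apply,
        Equiv.Perm.inv_eq_iff_eq.2 (vecSwap_involutive i a).symm]
    rw [hinv, hinv] at hω
    rcases lt_trichotomy (height (vecSwap i b)) (height (vecSwap i c)) with h | h | h
    · obtain rfl := eq_vecSwap_of_height_lt hb hc hbc h
      have hwt : vecWt i b ≠ 0 := by
        rw [height_vecSwap] at hbc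
        omega
      refine ⟨ω, ?_, Nat.lt_succ_self _⟩
      rw [ht.unique (interchanges_simple hwt), wordProd_cons, ← mul_assoc, simple_mul_self,
        one_mul]
    · exact absurd ((vecSwap i).injective (height_injective h)) fun h => hbc.ne' (h ▸ rfl)
    · obtain ⟨ω', hω', hlen⟩ :=
        ih (ht.conj i) (height_vecSwap_ne_zero hb) (height_vecSwap_ne_zero hc) h hω
      refine ⟨i :: ω', ?_, Nat.succ_lt_succ hlen⟩
      rw [wordProd_cons, hω', wordProd_cons]
      simp only [← mul_assoc, simple_mul_self, one_mul]

theorem length_simple_mul_lt {i : Fin n} {b : VecIdx n} (hb : 0 < vecWt i b) (w : weylGroup n)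
    (hw : height ((vecPerm n w)⁻¹ b) < height ((vecPerm n w)⁻¹ (vecSwap i b))) :
    length (simple i * w) < length w := by
  obtain ⟨ω, rfl, hlen⟩ := exists_reduced w
  have hne : height b ≠ 0 := by
    rintro h
    obtain rfl : b = .inr (.inl ()) := height_injective h
    exact hb.ne rfl
  obtain ⟨ω', hω', hlt⟩ := exchange (interchanges_simple hb.ne') hne (height_vecSwap_ne_zero hne)
    (by rw [height_vecSwap]; omega) ω hw
  exact hω' ▸ (length_wordProd_le ω').trans_lt (hlen ▸ hlt)

theorem lt_height_of_length_le {i : Fin n} {b : VecIdx n} (hb : 0 < vecWt i b)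
    {w : weylGroup n} (hw : length w ≤ length (simple i * w)) :
    height ((vecPerm n w)⁻¹ (vecSwap i b)) < height ((vecPerm n w)⁻¹ b) := by
  refine lt_of_le_of_ne (le_of_not_gt fun h => (length_simple_mul_lt hb w h).not_ge hw) fun h => ?_
  have := congrArg height ((Equiv.injective _ (height_injective h)))
  rw [height_vecSwap] at this
  omega

theorem IsLongest.height_lt {w : weylGroup n} (hw : IsLongest w) {i : Fin n} {b : VecIdx n}
    (hb : 0 < vecWt i b) :
    height ((vecPerm n w)⁻¹ b) < height ((vecPerm n w)⁻¹ (vecSwap i b)) := by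
  have h := lt_height_of_length_le (w := simple i * w) hb
    (by rw [← mul_assoc, simple_mul_self, one_mul]; exact hw _)
  have hinv (a : VecIdx n) :
      (vecPerm n (simple i * w))⁻¹ a = (vecPerm n w)⁻¹ (vecSwap i a) := by
    rw [map_mul, mul_inv_rev, vecPerm_simple, Equiv.Perm.mul_apply,
      Equiv.Perm.inv_eq_iff_eq.2 (vecSwap_involutive i a).symm]
  rwa [hinv, hinv, vecSwap_involutive] at h

theorem vecPerm_zero (w : weylGroup n) : vecPerm n w (.inr (.inl ())) = .inr (.inl ()) := by
  apply height_injective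
  have := congrArg height (vecPerm_bar w (.inr (.inl ())))
  rw [height_bar] at this
  simp only [bar] at this
  change _ = 0
  omega

theorem neg_le_height (b : VecIdx n) : -(n : ℤ) ≤ height b := by
  rcases b with j | u | j <;> simp only [height] <;> omega

theorem vecSwap_inl_self (i : Fin n) : vecSwap i (.inl i) =
    if h : i.val + 1 < n then .inl ⟨i + 1, h⟩ else .inr (.inr i) := by
  by_cases h : i.val + 1 < n
  · rw [vecSwap_inl, if_pos h, dif_pos h, nodeSwap_apply h, if_pos rfl]
  · rw [vecSwap_inl, if_neg h, dif_neg h, if_pos rfl]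

theorem IsLongest.height_vecPerm_inv_inl {w : weylGroup n} (hw : IsLongest w) (j : Fin n) :
    height ((vecPerm n w)⁻¹ (.inl j)) = j - n := by
  have hstep (i : Fin n) := hw.height_lt (i := i) (b := .inl i) (by
    simp only [vecWt, epsWt]
    split_ifs <;> decide)
  simp only [vecSwap_inl_self] at hstep
  have hlower (m : ℕ) (hm : m < n) : m - n ≤ height ((vecPerm n w)⁻¹ (.inl ⟨m, hm⟩)) := by
    induction m with
    | zero => exact (neg_le_height _).trans' (by simp)
    | succ m ih =>
      have := hstep ⟨m, by omega⟩
      simp only [dif_pos hm] at this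
      have := ih (by omega)
      push_cast
      omega
  have hupper (d m : ℕ) (hm : m + d + 1 = n) :
      height ((vecPerm n w)⁻¹ (.inl ⟨m, by omega⟩)) ≤ m - n := by
    induction d generalizing m with
    | zero =>
      have := hstep ⟨m, by omega⟩
      rw [dif_neg (by simpa using by omega), ← map_inv] at this
      have hbar := congrArg height (vecPerm_bar w⁻¹ (.inl ⟨m, by omega⟩))
      rw [height_bar, bar] at hbar
      rw [← map_inv]
      omega
    | succ d ih =>
      have := hstep ⟨m, by omega⟩
      simp only [dif_pos (show m + 1 < n by omega)] at this
      have := ih (m + 1) (by omega)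
      push_cast at this
      omega
  exact le_antisymm (hupper (n - 1 - j) j (by omega)) (hlower j j.2)

theorem IsLongest.vecPerm_eq_bar {w : weylGroup n} (hw : IsLongest w) (b : VecIdx n) :
    vecPerm n w b = bar b := by
  have hinl (j : Fin n) : vecPerm n w (.inr (.inr j)) = .inl j := by
    rw [← Equiv.Perm.eq_inv_iff_eq]
    apply height_injective
    rw [hw.height_vecPerm_inv_inl, height]
    ring
  rcases b with j | _ | j
  · exact (vecPerm_bar w (.inr (.inr j))).trans (congrArg bar (hinl j))
  · exact vecPerm_zero w
  · exact hinl j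

end Exchange

section SignedPermutations

/-- The sign by which `\bar s_i` acts on a basis vector of `V(Λ_1)`, besides permuting the basis
by `vecSwap i`. -/
def sBarSign (i : Fin n) (b : VecIdx n) : ℂ :=
  if vecWt i b = -1 ∨ ¬i.val + 1 < n ∧ b = .inr (.inl ()) then -1 else 1

theorem vecRep_sBar_apply (i : Fin n) (a b : VecIdx n) :
    vecRep n (sBar i) a b = if a = vecSwap i b then sBarSign i b else 0 := by
  have hrep : vecRep n (sBar i) = vecHom i !![0, -1; 1, 0] :=
    congrArg Matrix.toBlocks₁₁ (coe_sBar i)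
  rw [hrep]
  by_cases h : i.val + 1 < n
  · rw [vecHom, if_pos h, minusculeHom_apply, ← one_mul (minusculeMatrix _ _ _),
      mul_minusculeMatrix_apply]
    rcases vecWt_mem_of_lt h b with hb | hb | hb
    · simp [hb, sBarSign, Matrix.one_apply, apply_ite]
    · simp [hb, sBarSign, Matrix.one_apply, h, vecSwap_eq_self_iff.2 hb]
    · simp [hb, sBarSign, Matrix.one_apply, h]
  · have hodd : vecWt i b ≠ -1 := by
      rcases b with j | u | j <;> simp only [vecWt, epsWt, h, if_false]
      · split_ifs <;> omega
      · decide
      · split_ifs <;> omega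
    rw [vecHom, if_neg h, extendHom_apply, Matrix.add_apply, embed_apply]
    rcases a with a | ⟨⟨⟩⟩ | a <;> rcases b with b | ⟨⟨⟩⟩ | b
    all_goals
      simp [Fin.sum_univ_three, shortNode, symSquareHom, Matrix.one_apply, sBarSign, h, hodd,
        vecSwap_inl, vecSwap_inr_inl, vecSwap_inr_inr]
    all_goals grind

theorem mul_vecRep_sBar_apply {κ : Type*} (X : Matrix κ (VecIdx n) ℂ) (i : Fin n) (a : κ)
    (b : VecIdx n) : (X * vecRep n (sBar i)) a b = sBarSign i b * X a (vecSwap i b) := by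
  simp only [Matrix.mul_apply, vecRep_sBar_apply, mul_ite, mul_zero, Finset.sum_ite_eq',
    Finset.mem_univ, if_true, mul_comm]

theorem vecRep_sBar_mul_transpose (i : Fin n) :
    (vecRep n (sBar i))ᵀ * vecRep n (sBar i) = 1 := by
  ext a b
  rw [mul_vecRep_sBar_apply, Matrix.transpose_apply, vecRep_sBar_apply, Matrix.one_apply]
  simp only [(vecSwap i).apply_eq_iff_eq]
  by_cases hab : a = b
  · have hsq : sBarSign i b * sBarSign i b = 1 := by
      unfold sBarSign
      split_ifs <;> norm_num
    rw [if_pos hab.symm, if_pos hab, hab, hsq]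
  · rw [if_neg (Ne.symm hab), if_neg hab, mul_zero]

theorem vecRep_lift_inv (w : weylGroup n) :
    vecRep n (lift w)⁻¹ = (vecRep n (lift w))ᵀ := by
  have hprod (ω : List (Fin n)) :
      (vecRep n (ω.map sBar).prod)ᵀ * vecRep n (ω.map sBar).prod = 1 := by
    induction ω with
    | nil => simp
    | cons i ω ih =>
      rw [List.map_cons, List.prod_cons, map_mul, Matrix.transpose_mul, Matrix.mul_assoc,
        ← Matrix.mul_assoc _ (vecRep n (sBar i)), vecRep_sBar_mul_transpose, Matrix.one_mul, ih]
  calc vecRep n (lift w)⁻¹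
      = (vecRep n (lift w))ᵀ * vecRep n (lift w) * vecRep n (lift w)⁻¹ := by
        rw [show (vecRep n (lift w))ᵀ * vecRep n (lift w) = 1 from hprod _, Matrix.one_mul]
    _ = (vecRep n (lift w))ᵀ := by
        rw [Matrix.mul_assoc, ← map_mul, mul_inv_cancel, map_one, Matrix.mul_one]

theorem det_submatrix_mul_sBar {κ : Type*} [Fintype κ] [DecidableEq κ]
    (X : Matrix κ (VecIdx n) ℂ) (i : Fin n) (ι : κ → VecIdx n) :
    ((X * vecRep n (sBar i)).submatrix id ι).det =
      (∏ j, sBarSign i (ι j)) * (X.submatrix id (vecSwap i ∘ ι)).det := by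
  rw [← Matrix.det_mul_row]
  congr 1
  ext a j
  exact mul_vecRep_sBar_apply X i a (ι j)

/-- `ι` enumerates by decreasing height a set of basis vectors of `V(Λ_1)` which span an isotropic
subspace. -/
structure IsSortedIsotropic {m : ℕ} (ι : Fin m → VecIdx n) : Prop where
  strictAnti : StrictAnti (height ∘ ι)
  ne_bar : ∀ j j', ι j ≠ bar (ι j')

variable {m : ℕ} {ι : Fin m → VecIdx n}

theorem IsSortedIsotropic.injective (hι : IsSortedIsotropic ι) : Function.Injective ι :=
  hι.strictAnti.injective.of_comp

theorem height_eq_zero_iff_eq_bar {b : VecIdx n} : height b = 0 ↔ b = bar b := by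
  rw [← height_injective.eq_iff, height_bar]
  omega

theorem IsSortedIsotropic.height_ne_zero (hι : IsSortedIsotropic ι) (j : Fin m) :
    height (ι j) ≠ 0 :=
  mt height_eq_zero_iff_eq_bar.1 (hι.ne_bar j j)

theorem IsSortedIsotropic.sBarSign (hι : IsSortedIsotropic ι) (i : Fin n) (j : Fin m) :
    sBarSign i (ι j) = if vecWt i (ι j) = -1 then -1 else 1 := by
  have : ι j ≠ .inr (.inl ()) := fun h => hι.height_ne_zero j (by rw [h, height])
  simp [TypeB.sBarSign, this]

theorem IsSortedIsotropic.vecSwap_of_nonneg (hι : IsSortedIsotropic ι) {i : Fin n}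
    (hi : ∀ j, 0 ≤ vecWt i (ι j)) : IsSortedIsotropic (vecSwap i ∘ ι) where
  strictAnti j j' hjj' := by
    have hlt := hι.strictAnti hjj'
    refine lt_of_le_of_ne (le_of_not_gt fun h => ?_) fun h =>
      hlt.ne (congrArg height ((vecSwap i).injective (height_injective h)))
    have heq := eq_vecSwap_of_height_lt (hι.height_ne_zero j) (hι.height_ne_zero j') hlt h
    have hwt := vecWt_vecSwap i (ι j)
    have := hi j
    have := hi j'
    have hlt' : height (ι j') < height (ι j) := hlt
    rw [heq] at this hlt'
    rw [height_vecSwap] at hlt'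
    omega
  ne_bar j j' h := hι.ne_bar j j' ((vecSwap i).injective (h.trans (vecSwap_bar i _).symm))

theorem vecWt_eq_neg_one {i : Fin n} {b : VecIdx n} (hb : vecWt i b < 0)
    (hne : vecSwap i b ≠ bar b) : vecWt i b = -1 := by
  rw [← height_injective.ne_iff, height_vecSwap, height_bar] at hne
  rcases b with j | u | j <;> simp only [vecWt, epsWt, Fin.ext_iff, height, lt_self_iff_false] at *
  all_goals split_ifs at * <;> omega

theorem IsSortedIsotropic.vecSwap_comp (hι : IsSortedIsotropic ι) {i : Fin n} {j j' : Fin m}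
    (hj : vecWt i (ι j) ≠ 0) (hj' : ι j' = vecSwap i (ι j)) :
    vecSwap i ∘ ι = ι ∘ Equiv.swap j j' := by
  ext1 l
  rcases eq_or_ne l j with rfl | hlj
  · simp [hj']
  rcases eq_or_ne l j' with rfl | hlj'
  · simp [hj', vecSwap_involutive i (ι j)]
  rw [Function.comp_apply, Function.comp_apply, Equiv.swap_apply_of_ne_of_ne hlj hlj']
  by_contra h
  have := (interchanges_simple hj).mem_of_ne (ι l) (by rwa [vecPerm_simple])
  rw [← hj'] at this
  rcases this with h | h | h | h
  exacts [hlj (hι.injective h), hlj' (hι.injective h), hι.ne_bar _ _ h, hι.ne_bar _ _ h]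

theorem IsSortedIsotropic.det_mul_sBar_of_neg (hι : IsSortedIsotropic ι) {i : Fin n} {j j' : Fin m}
    (hj : vecWt i (ι j) < 0) (hj' : ι j' = vecSwap i (ι j)) (X : Matrix (Fin m) (VecIdx n) ℂ) :
    ((X * vecRep n (sBar i)).submatrix id ι).det = (X.submatrix id ι).det := by
  have hwt' : vecWt i (ι j') = -vecWt i (ι j) := by rw [hj', vecWt_vecSwap]
  have hne : j ≠ j' := by
    rintro rfl
    omega
  have hswap := hι.vecSwap_comp hj.ne hj'
  have hminus : vecWt i (ι j) = -1 :=
    vecWt_eq_neg_one hj fun h => hι.ne_bar _ _ (hj'.trans h)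
  have hsign : ∏ l, TypeB.sBarSign i (ι l) = -1 := by
    rw [Finset.prod_eq_single j, hι.sBarSign, if_pos hminus]
    · intro l _ hlj
      rw [hι.sBarSign, if_neg]
      rcases eq_or_ne l j' with rfl | hlj'
      · omega
      · have hfix := congrFun hswap l
        rw [Function.comp_apply, Function.comp_apply, Equiv.swap_apply_of_ne_of_ne hlj hlj',
          vecSwap_eq_self_iff] at hfix
        rw [hfix]
        decide
    · simp
  rw [det_submatrix_mul_sBar, hsign, hswap]
  have := (X.submatrix id ι).det_permute' (Equiv.swap j j')
  rw [Matrix.submatrix_submatrix, Function.comp_id, Equiv.Perm.sign_swap hne] at this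
  simp [this]

theorem IsSortedIsotropic.exists_det_mul_sBar (hι : IsSortedIsotropic ι) {i : Fin n}
    (hclosed : ∀ b, 0 < vecWt i b → vecSwap i b ∈ Set.range ι → b ∈ Set.range ι) :
    ∃ ι' : Fin m → VecIdx n, IsSortedIsotropic ι' ∧
      Set.range ι' = vecSwap i '' Set.range ι ∧ ∀ X : Matrix (Fin m) (VecIdx n) ℂ,
        ((X * vecRep n (sBar i)).submatrix id ι).det = (X.submatrix id ι').det := by
  by_cases hi : ∀ j, 0 ≤ vecWt i (ι j)
  · refine ⟨_, hι.vecSwap_of_nonneg hi, Set.range_comp _ _, fun X => ?_⟩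
    rw [det_submatrix_mul_sBar, Finset.prod_eq_one fun j _ => ?_, one_mul]
    rw [hι.sBarSign, if_neg fun h => absurd (hi j) (by omega)]
  · push Not at hi
    obtain ⟨j, hj⟩ := hi
    obtain ⟨j', hj'⟩ := hclosed (vecSwap i (ι j)) (by rw [vecWt_vecSwap]; omega)
      ⟨j, (vecSwap_involutive i _).symm⟩
    refine ⟨ι, hι, ?_, hι.det_mul_sBar_of_neg hj hj'⟩
    rw [← Set.range_comp, hι.vecSwap_comp hj.ne hj', EquivLike.range_comp]

end SignedPermutations

section Lifts

theorem isSortedIsotropic_topIdx (k : Fin n) : IsSortedIsotropic (topIdx k) where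
  strictAnti j j' h := by
    simp only [Function.comp_apply, topIdx, height, Fin.val_castLE]
    omega
  ne_bar j j' h := by simp [topIdx, bar] at h

theorem length_wordProd_of_cons {i : Fin n} {ω : List (Fin n)}
    (hω : length (wordProd (i :: ω)) = (i :: ω).length) : length (wordProd ω) = ω.length := by
  obtain ⟨ω', hω', hlen⟩ := exists_reduced (wordProd ω)
  have hle := length_wordProd_le (i :: ω')
  rw [wordProd_cons, hω', ← wordProd_cons, hω, List.length_cons, List.length_cons, hlen] at hle
  exact (length_wordProd_le ω).antisymm (Nat.le_of_succ_le_succ hle)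

theorem exists_sorted_of_reduced (k : Fin n) {ω : List (Fin n)}
    (hω : length (wordProd ω) = ω.length) :
    ∃ ι : Fin (k.val + 1) → VecIdx n, IsSortedIsotropic ι ∧
      Set.range ι = vecPerm n (wordProd ω) '' Set.range (topIdx k) ∧
      ∀ X : Matrix (Fin (k.val + 1)) (VecIdx n) ℂ,
        ((X * vecRep n (ω.map sBar).prod).submatrix id (topIdx k)).det =
          (X.submatrix id ι).det := by
  induction ω with
  | nil => exact ⟨topIdx k, isSortedIsotropic_topIdx k, by simp [wordProd], fun X => by simp⟩
  | cons i ω ih =>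
    obtain ⟨ι, hι, hrange, hdet⟩ := ih (length_wordProd_of_cons hω)
    have hclosed (b : VecIdx n) (hb : 0 < vecWt i b) (hmem : vecSwap i b ∈ Set.range ι) :
        b ∈ Set.range ι := by
      have hlt := lt_height_of_length_le hb (w := wordProd ω) (by
        rw [← wordProd_cons, hω, length_wordProd_of_cons hω]
        exact Nat.le_succ _)
      rw [hrange, Equiv.image_eq_preimage_symm, Set.mem_preimage, mem_range_topIdx] at hmem ⊢
      exact hmem.trans hlt.le
    obtain ⟨ι', hι', hrange', hdet'⟩ := hι.exists_det_mul_sBar hclosed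
    refine ⟨ι', hι', ?_, fun X => ?_⟩
    · rw [hrange', hrange, wordProd_cons, map_mul, vecPerm_simple, Equiv.Perm.coe_mul,
        Set.image_comp]
    · rw [List.map_cons, List.prod_cons, map_mul, ← Matrix.mul_assoc, hdet, hdet']

theorem det_submatrix_mul_lift {k : Fin n} {w : weylGroup n} {ι : Fin (k.val + 1) → VecIdx n}
    (hι : StrictAnti (height ∘ ι)) (hrange : Set.range ι = vecPerm n w '' Set.range (topIdx k))
    (X : Matrix (Fin (k.val + 1)) (VecIdx n) ℂ) :
    ((X * vecRep n (lift w)).submatrix id (topIdx k)).det = (X.submatrix id ι).det := by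
  have hword : wordProd (reducedWord w) = w := (exists_reduced w).choose_spec.1
  have hlength : (reducedWord w).length = length w := (exists_reduced w).choose_spec.2
  obtain ⟨ι', hι', hrange', hdet⟩ := exists_sorted_of_reduced k
    (ω := reducedWord w) (by rw [hword, hlength])
  rw [hword, ← hrange] at hrange'
  obtain rfl : ι' = ι := height_injective.comp_left
    ((hι'.strictAnti.range_inj hι).1 (by rw [Set.range_comp, Set.range_comp, hrange']))
  exact hdet X

theorem leadingMinor_lift {k : Fin n} {u v : weylGroup n} {ι κ : Fin (k.val + 1) → VecIdx n}
    (hι : StrictAnti (height ∘ ι)) (hι_range : Set.range ι = vecPerm n u '' Set.range (topIdx k))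
    (hκ : StrictAnti (height ∘ κ)) (hκ_range : Set.range κ = vecPerm n v '' Set.range (topIdx k))
    (g : grp n) :
    leadingMinor k ((lift u)⁻¹ * g * lift v).1.1 = ((vecRep n g).submatrix ι κ).det := by
  let L := (vecRep n (lift u))ᵀ
  calc leadingMinor k ((lift u)⁻¹ * g * lift v).1.1
      = (((L * vecRep n g).submatrix (topIdx k) id * vecRep n (lift v)).submatrix id
          (topIdx k)).det := by
        change ((vecRep n _).submatrix _ _).det = _
        rw [map_mul, map_mul, vecRep_lift_inv]
        rfl
    _ = (((L * vecRep n g).submatrix (topIdx k) id).submatrix id κ).det :=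
        det_submatrix_mul_lift hκ hκ_range _
    _ = ((((vecRep n g).submatrix id κ)ᵀ * vecRep n (lift u)).submatrix id (topIdx k)).det := by
        rw [← Matrix.det_transpose, ← Matrix.transpose_transpose (vecRep n (lift u)),
          ← Matrix.transpose_mul]
        rfl
    _ = (((vecRep n g).submatrix id κ)ᵀ.submatrix id ι).det := det_submatrix_mul_lift hι hι_range _
    _ = ((vecRep n g).submatrix ι κ).det := by
        rw [← Matrix.det_transpose]
        rfl

end Lifts

section YBoldRows

variable (X : Matrix (VecIdx n) (VecIdx n) ℂ)

theorem vecRep_yBold_mul_of_lt {i : Fin n} (h : i.val + 1 < n) (c : ℂˣ) (a b : VecIdx n) :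
    (vecRep n (yBold i c) * X) a b =
      if vecWt i a = 1 then (c : ℂ)⁻¹ * X a b
      else if vecWt i a = -1 then X (vecSwap i a) b + c * X a b
      else X a b := by
  rw [vecRep_yBold, vecHom, if_pos h, minusculeHom_apply,
    minusculeMatrix_mul_apply (vecSwap_involutive i) (vecWt_vecSwap i)]
  simp

theorem vecRep_yBold_mul_of_not_lt {i : Fin n} (h : ¬i.val + 1 < n) (c : ℂˣ) (a b : VecIdx n) :
    (vecRep n (yBold i c) * X) a b = X a b +
      ∑ k, if a = shortNode i k then
        ∑ l, (symSquareHom !![(c : ℂ)⁻¹, 0; 1, (c : ℂ)] - 1) k l * X (shortNode i l) b else 0 := by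
  have hsub : (1 : Matrix (VecIdx n) (VecIdx n) ℂ).submatrix (shortNode i) id * X =
      X.submatrix (shortNode i) id := by
    rw [← Matrix.submatrix_id_id X, ← Matrix.submatrix_mul _ _ _ _ _ Function.bijective_id]
    simp
  rw [vecRep_yBold, vecHom, if_neg h, extendHom_apply, Matrix.add_mul, Matrix.one_mul,
    Matrix.add_apply, embed, inclusion, Matrix.mul_assoc, Matrix.mul_assoc,
    Matrix.transpose_submatrix, Matrix.transpose_one, hsub, Matrix.mul_apply]
  simp [Matrix.one_apply, Matrix.mul_apply]

theorem vecRep_yBold_mul_inr (i j : Fin n) (c : ℂˣ) (b : VecIdx n) :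
    (vecRep n (yBold i c) * X) (.inr (.inr j)) b =
      if j = i then
        if h : i.val + 1 < n then c * X (.inr (.inr i)) b + X (.inr (.inr ⟨i + 1, h⟩)) b
        else X (.inl i) b + 2 * c * X (.inr (.inl ())) b + c ^ 2 * X (.inr (.inr i)) b
      else if j.val = i.val + 1 then (c : ℂ)⁻¹ * X (.inr (.inr j)) b
      else X (.inr (.inr j)) b := by
  by_cases h : i.val + 1 < n
  · rw [vecRep_yBold_mul_of_lt X h]
    simp [vecWt, epsWt, vecSwap_inr_inr, nodeSwap_apply h, h]
    grind
  · rw [vecRep_yBold_mul_of_not_lt X h]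
    simp [Fin.sum_univ_three, shortNode, symSquareHom, h]
    grind

theorem vecRep_yBold_mul_inl (i j : Fin n) (c : ℂˣ) (b : VecIdx n) :
    (vecRep n (yBold i c) * X) (.inl j) b =
      if j = i then (if i.val + 1 < n then (c : ℂ)⁻¹ else (c : ℂ)⁻¹ ^ 2) * X (.inl i) b
      else if j.val = i.val + 1 then X (.inl i) b + c * X (.inl j) b
      else X (.inl j) b := by
  by_cases h : i.val + 1 < n
  · rw [vecRep_yBold_mul_of_lt X h]
    simp [vecWt, epsWt, vecSwap_inl, nodeSwap_apply h, h]
    grind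
  · rw [vecRep_yBold_mul_of_not_lt X h]
    simp [Fin.sum_univ_three, shortNode, symSquareHom, h]
    grind

theorem vecRep_yBold_mul_zero (i : Fin n) (c : ℂˣ) (b : VecIdx n) :
    (vecRep n (yBold i c) * X) (.inr (.inl ())) b =
      X (.inr (.inl ())) b + if i.val + 1 < n then 0 else (c : ℂ)⁻¹ * X (.inl i) b := by
  by_cases h : i.val + 1 < n
  · rw [vecRep_yBold_mul_of_lt X h]
    simp [vecWt, h]
  · rw [vecRep_yBold_mul_of_not_lt X h]
    simp [Fin.sum_univ_three, shortNode, symSquareHom, h]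

end YBoldRows

section Cascade

variable {K : Type*} [Field K]

theorem det_eq_prod_mul_det_of_forall_row {m : ℕ} {A B : Matrix (Fin (m + 1)) (Fin (m + 1)) K}
    (a x : Fin m → K) (h_zero : ∀ j, A 0 j = B 0 j)
    (h_succ : ∀ i j, A i.succ j = a i * (B i.succ j + x i * A i.castSucc j)) :
    A.det = (∏ i, a i) * B.det := by
  rw [Matrix.det_eq_of_forall_row_eq_smul_add_pred (A := A)
    (B := Matrix.of fun i j => (Fin.cons 1 a : Fin (m + 1) → K) i * B i j) (fun i => a i * x i)
    (by simp [h_zero]) (by simp [h_succ, mul_add, mul_assoc]), Matrix.det_mul_column]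
  simp [Fin.prod_univ_succ]

/-- A sequence of arrays `b p`, each obtained from the next by the recursion that the product of
the `𝐲_i(c_i)` induces on matrix entries, where `γ p j` stands for `c^{(p)}_j`. The array `b p` is
supported on the columns `q ≥ p`. Indices are natural numbers, and only those below `N` matter. -/
structure IsCascade (N : ℕ) (γ : ℕ → ℕ → K) (b : ℕ → ℕ → ℕ → K) : Prop where
  ne_zero (p j : ℕ) : γ p j ≠ 0
  zero (p : ℕ) : γ p 0 = 1
  recursion {p j : ℕ} (hp : p < N) (hj : j + 1 < N) (q : ℕ) :
    b p j q = γ p (j + 1) / γ p j * (b (p + 1) j q + b p (j + 1) q)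
  eq_zero {p j q : ℕ} (hp : p ≤ N) (hj : j < N) (hq : q < p) : b p j q = 0
  diagonal {p j : ℕ} (hp : p < N) (hj : j < N) : b p j p = (γ p j)⁻¹

/-- The square matrix with first row `r` and further rows `m - 1, …, 0` of `b p`, in the columns
`p, …, p + m`. -/
def cascadeMatrix (b : ℕ → ℕ → ℕ → K) (p m : ℕ) (r : ℕ → K) :
    Matrix (Fin (m + 1)) (Fin (m + 1)) K :=
  Matrix.of fun i q => Matrix.vecCons r (fun i' : Fin m => b p (m - 1 - i')) i (p + q)

variable {N : ℕ} {γ : ℕ → ℕ → K} {b : ℕ → ℕ → ℕ → K}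

theorem det_cascadeMatrix_add_smul (p m : ℕ) (r s : ℕ → K) (a : K) :
    (cascadeMatrix b p m (r + a • s)).det =
      (cascadeMatrix b p m r).det + a * (cascadeMatrix b p m s).det := by
  have hupdate (t : ℕ → K) : cascadeMatrix b p m t =
      (cascadeMatrix b p m 0).updateRow 0 fun q => t (p + q) := by
    ext i q
    cases i using Fin.cases <;> simp [cascadeMatrix]
  rw [hupdate r, hupdate s, hupdate (r + a • s), ← Matrix.det_updateRow_smul,
    ← Matrix.det_updateRow_add]
  rfl

namespace IsCascade

variable (h : IsCascade N γ b)

include h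

theorem prod_ratio (p m : ℕ) :
    ∏ i : Fin m, γ p (m - 1 - i + 1) / γ p (m - 1 - i) = γ p m := by
  rw [Fin.prod_univ_eq_prod_range fun i => γ p (m - 1 - i + 1) / γ p (m - 1 - i),
    Finset.prod_range_reflect fun i => γ p (i + 1) / γ p i]
  induction m with
  | zero => simp [h.zero]
  | succ m ih => rw [Finset.prod_range_succ, ih, mul_div_cancel₀ _ (h.ne_zero p m)]

theorem det_cascadeMatrix_succ {p m : ℕ} (hp : p < N) (hm : m < N) {r u : ℕ → K} {x : K}
    (hu : u p = 0) (hrow : ∀ q, b p m q = γ p (m + 1) / γ p m * (u q + x * r q)) :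
    (cascadeMatrix b p (m + 1) r).det =
      r p * γ p (m + 1) * (cascadeMatrix b (p + 1) m u).det := by
  let B : Matrix (Fin (m + 2)) (Fin (m + 2)) K := Matrix.of fun i q =>
    Matrix.vecCons r (Matrix.vecCons u fun i' : Fin m => b (p + 1) (m - 1 - i')) i (p + q)
  have hB : B.det = r p * (cascadeMatrix b (p + 1) m u).det := by
    have hcol (i : Fin (m + 1)) : B i.succ 0 = 0 := by
      cases i using Fin.cases with
      | zero => simpa [B] using hu
      | succ i => simpa [B] using h.eq_zero hp (by omega) p.lt_succ_self
    rw [Matrix.det_succ_column_zero, Fin.sum_univ_succ, Finset.sum_eq_zero fun i _ => by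
      rw [hcol, mul_zero, zero_mul]]
    have hminor : B.submatrix (Fin.succAbove 0) Fin.succ = cascadeMatrix b (p + 1) m u := by
      ext i q
      simp [B, cascadeMatrix, add_assoc, add_comm 1]
    rw [Fin.val_zero, pow_zero, one_mul, hminor, add_zero]
    rfl
  rw [det_eq_prod_mul_det_of_forall_row (B := B)
    (fun i => γ p (m + 1 - 1 - i + 1) / γ p (m + 1 - 1 - i)) (Matrix.vecCons x 1),
    h.prod_ratio, hB]
  · ring
  · simp [B, cascadeMatrix]
  · intro i q
    cases i using Fin.cases with
    | zero => simpa [B, cascadeMatrix] using hrow (p + q)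
    | succ i =>
      have hi : m - i = m - 1 - i + 1 := by omega
      have hi' : m - (i + 1) = m - 1 - i := by omega
      simpa [B, cascadeMatrix, hi, hi'] using h.recursion hp (j := m - 1 - i) (by omega) (p + q)

theorem det_cascadeMatrix_self {p m : ℕ} (hpm : p + m < N) :
    (cascadeMatrix b p m (b p m)).det = 1 := by
  induction m generalizing p with
  | zero => simp [cascadeMatrix, h.diagonal (p := p) (j := 0) (by omega) (by omega), h.zero]
  | succ m ih =>
    rw [h.det_cascadeMatrix_succ (u := b (p + 1) m) (x := 1) (by omega) (by omega)
      (h.eq_zero (by omega) (by omega) p.lt_succ_self), ih (by omega),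
      h.diagonal (by omega) (by omega), mul_one, inv_mul_cancel₀ (h.ne_zero p (m + 1))]
    simpa using h.recursion (by omega) (by omega)

theorem det_cascadeMatrix_next {p m : ℕ} (hpm : p + m < N) (hm : m + 1 < N) :
    (cascadeMatrix b p m (b p (m + 1))).det =
      ∑ j ∈ Finset.range (m + 1), γ (p + j) (m - j) / γ (p + j) (m - j + 1) := by
  induction m generalizing p with
  | zero => simp [cascadeMatrix, h.diagonal (p := p) (j := 1) (by omega) (by omega), h.zero]
  | succ m ih =>
    have hu : (b (p + 1) m + (γ p (m + 2) / γ p (m + 1)) • b (p + 1) (m + 1)) p = 0 := by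
      simp [h.eq_zero (p := p + 1) (q := p) (by omega) (show m < N by omega),
        h.eq_zero (p := p + 1) (q := p) (by omega) (show m + 1 < N by omega)]
    have hrow (q : ℕ) : b p m q = γ p (m + 1) / γ p m *
        ((b (p + 1) m + (γ p (m + 2) / γ p (m + 1)) • b (p + 1) (m + 1)) q +
          γ p (m + 2) / γ p (m + 1) * b p (m + 2) q) := by
      rw [h.recursion (by omega) (by omega), h.recursion (j := m + 1) (by omega) (by omega)]
      simp [mul_add, add_assoc]
    have hsum : ∑ j ∈ Finset.range (m + 2), γ (p + j) (m + 1 - j) / γ (p + j) (m + 1 - j + 1) =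
        (∑ j ∈ Finset.range (m + 1), γ (p + 1 + j) (m - j) / γ (p + 1 + j) (m - j + 1)) +
          γ p (m + 1) / γ p (m + 2) := by
      simp [Finset.sum_range_succ' _ (m + 1), add_assoc, add_comm 1]
    rw [h.det_cascadeMatrix_succ (by omega) (by omega) hu hrow, det_cascadeMatrix_add_smul,
      h.det_cascadeMatrix_self (by omega), ih (by omega) (by omega),
      h.diagonal (by omega) (by omega), hsum]
    have := h.ne_zero p (m + 1)
    have := h.ne_zero p (m + 2)
    field_simp
    ring

end IsCascade

end Cascade

section TailProducts

/-- The product `f i * f (i + 1) * ⋯ * f (n - 1)`, which is `1` for `n ≤ i`. -/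
def tailProd {M : Type*} [Monoid M] (f : Fin n → M) (i : ℕ) : M := ((List.ofFn f).drop i).prod

theorem tailProd_self {M : Type*} [Monoid M] (f : Fin n → M) : tailProd f n = 1 := by
  rw [tailProd, List.drop_eq_nil_of_le (by simp), List.prod_nil]

theorem tailProd_eq_mul {M : Type*} [Monoid M] (f : Fin n → M) (i : Fin n) :
    tailProd f i = f i * tailProd f (i + 1) := by
  rw [tailProd, List.drop_eq_getElem_cons (by simp)]
  simp [tailProd]

end TailProducts

section TailBlocks

/-- The action of `𝐲_{i+1}(c_{i+1}) ⋯ 𝐲_n(c_n)` on `V(Λ_1)`, with `i` counted from `0`. -/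
noncomputable def tailBlock (c : Fin n → ℂˣ) (i : ℕ) : Matrix (VecIdx n) (VecIdx n) ℂ :=
  vecRep n (tailProd (fun j => yBold j (c j)) i)

variable (c : Fin n → ℂˣ) (X : Matrix (VecIdx n) (VecIdx n) ℂ)

theorem tailBlock_self_mul : tailBlock c n * X = X := by
  rw [tailBlock, tailProd_self, map_one, Matrix.one_mul]

theorem tailBlock_mul (i : Fin n) :
    tailBlock c i * X = vecRep n (yBold i (c i)) * (tailBlock c (i + 1) * X) := by
  rw [tailBlock, tailProd_eq_mul, map_mul, Matrix.mul_assoc, tailBlock]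

theorem tailBlock_mul_row_eq {a b : ℕ} (hab : a ≤ b) (hbn : b ≤ n) {r q : VecIdx n}
    (h : ∀ i : Fin n, a ≤ i → i < b → ∀ Z : Matrix (VecIdx n) (VecIdx n) ℂ,
      (vecRep n (yBold i (c i)) * Z) r q = Z r q) :
    (tailBlock c a * X) r q = (tailBlock c b * X) r q := by
  induction b, hab using Nat.le_induction with
  | base => rfl
  | succ b hab ih =>
    rw [ih (by omega) fun i hai hib => h i hai (hib.trans b.lt_succ_self),
      tailBlock_mul c X ⟨b, hbn⟩]
    exact h ⟨b, hbn⟩ hab b.lt_succ_self _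

theorem tailBlock_mul_inr_of_lt {i : ℕ} (hi : i ≤ n) {j : Fin n} (hj : j < i) (q : VecIdx n) :
    (tailBlock c i * X) (.inr (.inr j)) q = X (.inr (.inr j)) q := by
  rw [tailBlock_mul_row_eq c X hi le_rfl, tailBlock_self_mul]
  intro k hik _ Z
  rw [vecRep_yBold_mul_inr, if_neg (by omega), if_neg (by omega)]

theorem tailBlock_mul_inl_of_lt {i : ℕ} (hi : i ≤ n) {j : Fin n} (hj : j < i) (q : VecIdx n) :
    (tailBlock c i * X) (.inl j) q = X (.inl j) q := by
  rw [tailBlock_mul_row_eq c X hi le_rfl, tailBlock_self_mul]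
  intro k hik _ Z
  rw [vecRep_yBold_mul_inl, if_neg (by omega), if_neg (by omega)]

/-- The variable `c_j` for `j` counted from `1`, with `c_0 = 1`. -/
def shifted (c : Fin n → ℂˣ) (j : ℕ) : ℂˣ :=
  if h : 0 < j ∧ j ≤ n then c ⟨j - 1, by omega⟩ else 1

theorem shifted_zero : shifted c 0 = 1 := rfl

theorem shifted_succ (j : Fin n) : shifted c (j + 1) = c j := by
  simp [shifted]

theorem tailBlock_zero_mul_inr (j : Fin n) (q : VecIdx n) :
    (tailBlock c 0 * X) (.inr (.inr j)) q =
      (shifted c j : ℂ)⁻¹ * (tailBlock c j * X) (.inr (.inr j)) q := by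
  obtain ⟨j, hj⟩ := j
  cases j with
  | zero => simp [shifted_zero]
  | succ j =>
    have hjn : j < n := by omega
    rw [tailBlock_mul_row_eq c X (Nat.zero_le j) hjn.le, tailBlock_mul c X ⟨j, hjn⟩,
      vecRep_yBold_mul_inr, if_neg (by simp), if_pos rfl, ← shifted_succ c ⟨j, hjn⟩]
    intro k _ hk Z
    rw [vecRep_yBold_mul_inr, if_neg (by grind), if_neg (by grind)]

theorem tailBlock_zero_mul_inr_of_lt {j : Fin n} (hj : j.val + 1 < n) (q : VecIdx n) :
    (tailBlock c 0 * X) (.inr (.inr j)) q = shifted c (j + 1) / shifted c j *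
      (X (.inr (.inr j)) q + (tailBlock c 0 * X) (.inr (.inr ⟨j + 1, hj⟩)) q) := by
  rw [tailBlock_zero_mul_inr, tailBlock_zero_mul_inr c X ⟨j + 1, hj⟩, tailBlock_mul,
    vecRep_yBold_mul_inr, if_pos rfl, dif_pos hj,
    tailBlock_mul_inr_of_lt c X (by omega) j.val.lt_succ_self, shifted_succ]
  field_simp

theorem tailBlock_zero_mul_inr_last {j : Fin n} (hj : j.val + 1 = n) (q : VecIdx n) :
    (tailBlock c 0 * X) (.inr (.inr j)) q = (shifted c j : ℂ)⁻¹ * (X (.inl j) q +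
      2 * c j * X (.inr (.inl ())) q + c j ^ 2 * X (.inr (.inr j)) q) := by
  rw [tailBlock_zero_mul_inr, tailBlock_mul, hj, tailBlock_self_mul,
    vecRep_yBold_mul_inr, if_pos rfl, dif_neg (by omega)]

theorem tailBlock_zero_mul_zero {j : Fin n} (hj : j.val + 1 = n) (q : VecIdx n) :
    (tailBlock c 0 * X) (.inr (.inl ())) q =
      X (.inr (.inl ())) q + (c j : ℂ)⁻¹ * X (.inl j) q := by
  rw [tailBlock_mul_row_eq c X (Nat.zero_le j) j.isLt.le, tailBlock_mul, hj, tailBlock_self_mul,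
    vecRep_yBold_mul_zero, if_neg (by omega)]
  intro k _ hk Z
  rw [vecRep_yBold_mul_zero, if_pos (by omega), add_zero]

theorem exists_tailBlock_mul_inl (j : Fin n) :
    ∃ a : ℂ, ∀ (X : Matrix (VecIdx n) (VecIdx n) ℂ) (q : VecIdx n),
      (tailBlock c j * X) (.inl j) q = a * X (.inl j) q := by
  refine ⟨if j.val + 1 < n then (c j : ℂ)⁻¹ else (c j : ℂ)⁻¹ ^ 2, fun X q => ?_⟩
  rw [tailBlock_mul, vecRep_yBold_mul_inl, if_pos rfl,
    tailBlock_mul_inl_of_lt c X (by omega) j.val.lt_succ_self]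

theorem exists_tailBlock_zero_mul_inl (j : Fin n) :
    ∃ a : ℂ, ∀ (X : Matrix (VecIdx n) (VecIdx n) ℂ) (q : VecIdx n),
      (tailBlock c 0 * X) (.inl j) q = a * X (.inl j) q +
        if 0 < j.val then X (.inl ⟨j - 1, by omega⟩) q else 0 := by
  obtain ⟨a, ha⟩ := exists_tailBlock_mul_inl c j
  obtain ⟨j, hj⟩ := j
  cases j with
  | zero => exact ⟨a, fun X q => by simpa using ha X q⟩
  | succ j =>
    refine ⟨c ⟨j, by omega⟩ * a, fun X q => ?_⟩
    have hjn : j < n := by omega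
    rw [tailBlock_mul_row_eq c X (Nat.zero_le j) hjn.le, tailBlock_mul c X ⟨j, hjn⟩,
      vecRep_yBold_mul_inl, if_neg (by simp), if_pos rfl, ha,
      tailBlock_mul_inl_of_lt c X hj.le (j := ⟨j, hjn⟩) j.lt_succ_self, if_pos j.succ_pos]
    · simp only [Nat.add_sub_cancel]
      ring
    · intro k _ hk Z
      rw [vecRep_yBold_mul_inl, if_neg (by grind), if_neg (by grind)]

end TailBlocks

section Theta

variable (c : Fin n → Fin n → ℂˣ)

/-- The action of the last `n - p` of the `n` factors of `Θ⁻_{𝐢₀}(c)` on `V(Λ_1)`. -/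
noncomputable def tailTheta (p : ℕ) : Matrix (VecIdx n) (VecIdx n) ℂ :=
  vecRep n (tailProd (fun p => tailProd (fun i => yBold i (c p i)) 0) p)

theorem tailTheta_zero : tailTheta c 0 = vecRep n (theta c) := rfl

theorem tailTheta_self : tailTheta c n = 1 := by
  rw [tailTheta, tailProd_self, map_one]

theorem tailTheta_eq_mul {p : ℕ} (hp : p < n) :
    tailTheta c p = tailBlock (c ⟨p, hp⟩) 0 * tailTheta c (p + 1) := by
  rw [tailTheta, tailProd_eq_mul _ ⟨p, hp⟩, map_mul, tailBlock, tailTheta]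

theorem tailTheta_inl_inl {p : ℕ} (hp : p ≤ n) {j m : Fin n} (hjm : m + (n - p) ≤ j.val) :
    tailTheta c p (.inl j) (.inl m) = if m + (n - p) = j.val then 1 else 0 := by
  induction hp using Nat.decreasingInduction generalizing j with
  | self =>
    simp [tailTheta_self, Matrix.one_apply, Fin.ext_iff, eq_comm]
  | of_succ p hp ih =>
    obtain ⟨a, ha⟩ := exists_tailBlock_zero_mul_inl (c ⟨p, hp⟩) j
    rw [tailTheta_eq_mul c hp, ha, ih (by omega), if_neg (by omega), if_pos (by omega),
      ih (by simp only; omega)]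
    grind

theorem tailTheta_zero_inl {p : ℕ} (hp : p ≤ n) {m : Fin n} (hm : m < p) :
    tailTheta c p (.inr (.inl ())) (.inl m) = 0 := by
  induction hp using Nat.decreasingInduction with
  | self => simp [tailTheta_self]
  | of_succ p hp ih =>
    rw [tailTheta_eq_mul c hp, tailBlock_zero_mul_zero _ _ (j := ⟨n - 1, by omega⟩) (by grind),
      ih (by omega), tailTheta_inl_inl c hp (by grind), if_neg (by grind), mul_zero, add_zero]

theorem tailTheta_inr_inl {p : ℕ} (hp : p ≤ n) {j m : Fin n} (hm : m ≤ p) :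
    tailTheta c p (.inr (.inr j)) (.inl m) =
      if m = p then (shifted (c m) j : ℂ)⁻¹ else 0 := by
  induction hp using Nat.decreasingInduction generalizing j with
  | self => simp [tailTheta_self, m.isLt.ne]
  | of_succ p hp ih =>
    have hzero (j : Fin n) : tailTheta c (p + 1) (.inr (.inr j)) (.inl m) = 0 := by
      rw [ih (by omega), if_neg (by omega)]
    have hγ (h : m.val = p) (j : ℕ) : shifted (c ⟨p, hp⟩) j = shifted (c m) j := by
      subst h
      rfl
    rw [tailTheta_eq_mul c hp]
    obtain ⟨j, hj⟩ := j
    induction Nat.le_sub_one_of_lt hj using Nat.decreasingInduction with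
    | self =>
      rw [tailBlock_zero_mul_inr_last _ _ (by simp only; omega), hzero, tailTheta_zero_inl c hp
        (by omega), tailTheta_inl_inl c hp (by simp only; omega)]
      by_cases h : m.val = p
      · rw [if_pos (by simp only; omega), if_pos h, hγ h]
        ring
      · rw [if_neg (by simp only; omega), if_neg h]
        ring
    | of_succ j hjn ihj =>
      rw [tailBlock_zero_mul_inr_of_lt _ _ (by simp only; omega), hzero, ihj]
      by_cases h : m.val = p
      · rw [if_pos h, if_pos h, hγ h, hγ h]
        field_simp
        ring
      · simp [h]

/-- The entry of `tailTheta c p` in the row of `v_{j̄}` and the column of `v_q`. -/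
noncomputable def tailThetaEntry (p j q : ℕ) : ℂ :=
  if h : j < n ∧ q < n then tailTheta c p (.inr (.inr ⟨j, h.1⟩)) (.inl ⟨q, h.2⟩) else 0

theorem isCascade_tailThetaEntry : IsCascade n
    (fun p j => if h : p < n then (shifted (c ⟨p, h⟩) j : ℂ) else 1) (tailThetaEntry c) where
  ne_zero p j := by
    split_ifs <;> simp
  zero p := by simp [shifted_zero]
  recursion {p j} hp hj q := by
    simp only [tailThetaEntry, dif_pos hp, tailTheta_eq_mul c hp]
    by_cases hq : q < n
    · rw [dif_pos ⟨by omega, hq⟩, dif_pos ⟨by omega, hq⟩, dif_pos ⟨by omega, hq⟩,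
        tailBlock_zero_mul_inr_of_lt _ _ hj]
    · simp [hq]
  eq_zero {p j q} hp hj hq := by
    rw [tailThetaEntry, dif_pos ⟨hj, by omega⟩, tailTheta_inr_inl c hp hq.le, if_neg hq.ne]
  diagonal {p j} hp hj := by
    rw [tailThetaEntry, dif_pos ⟨hj, hp⟩, tailTheta_inr_inl c hp.le le_rfl, if_pos rfl, dif_pos hp]

end Theta

section Minor

variable {k : Fin n} (hk : k.val + 1 < n)

theorem vecSwap_topIdx (j : Fin (k.val + 1)) :
    vecSwap k (topIdx k j) = .inl (if j.val = k then ⟨k + 1, hk⟩ else Fin.castLE k.2 j) := by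
  rw [topIdx, vecSwap_inl, if_pos hk, nodeSwap_apply hk]
  have := j.isLt
  simp [Fin.ext_iff]
  grind

/-- The basis vectors `v_{j̄}` for `j = k + 2, k, k - 1, …, 1`, whose weights are the
`w_0 s_{k+1} ε_j` for `j ≤ k + 1`, by decreasing height. -/
def rowIdx : Fin (k.val + 1) → VecIdx n :=
  Matrix.vecCons (.inr (.inr ⟨k + 1, hk⟩)) fun i => .inr (.inr ⟨k - 1 - i, by omega⟩)

theorem strictAnti_height_rowIdx : StrictAnti (height ∘ rowIdx hk) := by
  intro i j hij
  cases j using Fin.cases with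
  | zero => exact absurd hij (Fin.not_lt_zero i)
  | succ j =>
    have := j.isLt
    cases i using Fin.cases with
    | zero => simp [rowIdx, height]; omega
    | succ i =>
      have : i.val < j.val := by simpa using hij
      simp [rowIdx, height]; omega

theorem rowIdx_eq_bar_vecSwap (j : Fin (k.val + 1)) :
    rowIdx hk j = bar (vecSwap k (topIdx k j.rev)) := by
  rw [vecSwap_topIdx hk]
  cases j using Fin.cases with
  | zero => simp [rowIdx, bar]
  | succ j =>
    have := j.isLt
    simp [rowIdx, bar, Fin.ext_iff, Fin.val_rev]
    grind

theorem range_rowIdx {w₀ : weylGroup n} (hw₀ : IsLongest w₀) :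
    Set.range (rowIdx hk) = vecPerm n (w₀ * simple k) '' Set.range (topIdx k) := by
  have hrow : rowIdx hk = vecPerm n (w₀ * simple k) ∘ topIdx k ∘ Fin.rev := by
    ext1 j
    rw [rowIdx_eq_bar_vecSwap, map_mul, vecPerm_simple]
    exact (hw₀.vecPerm_eq_bar _).symm
  rw [hrow, Set.range_comp, Fin.rev_surjective.range_comp]

theorem submatrix_theta (c : Fin n → Fin n → ℂˣ) :
    (vecRep n (theta c)).submatrix (rowIdx hk) (topIdx k) =
      cascadeMatrix (tailThetaEntry c) 0 k (tailThetaEntry c 0 (k + 1)) := by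
  ext i q
  have hq : q < n := by omega
  have := k.isLt
  cases i using Fin.cases with
  | zero =>
    simp [cascadeMatrix, rowIdx, topIdx, tailThetaEntry, tailTheta_zero, hk, hq]
    rfl
  | succ i =>
    have hi : k.val - 1 - i < n := by omega
    simp [cascadeMatrix, rowIdx, topIdx, tailThetaEntry, tailTheta_zero, hi, hq]
    rfl

theorem det_submatrix_theta (c : Fin n → Fin n → ℂˣ) :
    ((vecRep n (theta c)).submatrix (rowIdx hk) (topIdx k)).det =
      1 / (c k ⟨0, k.pos⟩ : ℂ) + ∑ j : Fin k.val,
        (c ⟨j, j.isLt.trans k.isLt⟩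
            ⟨k - j - 1, ((Nat.sub_le _ 1).trans (Nat.sub_le _ _)).trans_lt k.isLt⟩ : ℂ) /
          (c ⟨j, j.isLt.trans k.isLt⟩ ⟨k - j, (Nat.sub_le _ _).trans_lt k.isLt⟩ : ℂ) := by
  rw [submatrix_theta, (isCascade_tailThetaEntry c).det_cascadeMatrix_next (by omega) hk,
    Finset.sum_range_succ, add_comm, Finset.sum_range]
  congr 1
  · have := shifted_succ (c k) ⟨0, by omega⟩
    simp_all [shifted_zero]
  · refine Finset.sum_congr rfl fun j _ => ?_
    have hj : k.val - j - 1 + 1 = k - j := by omega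
    have hnum := shifted_succ (c ⟨j, by omega⟩) ⟨k - j - 1, by omega⟩
    have hden := shifted_succ (c ⟨j, by omega⟩) ⟨k - j, by omega⟩
    simp_all [j.isLt.trans k.isLt]

end Minor

end TypeB

/-- The index `k : Fin n` stands for `k + 1 ∈ {1, …, n - 1}`, and likewise for `j` and for the
indices of `c`, where `c p i` is the variable `c^{(p+1)}_{i+1}`. -/
theorem mainTheorem6 (n : ℕ) (k : Fin n) (hk : k.val + 1 < n)
    (w₀ : TypeB.weylGroup n) (hw₀ : TypeB.IsLongest w₀) (c : Fin n → Fin n → ℂˣ) :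
    TypeB.genMinor (TypeB.fundWeight k)
        ((w₀ * TypeB.simple k).1 (TypeB.fundWeight k)) (TypeB.fundWeight k) (TypeB.theta c) =
      1 / (c k ⟨0, by omega⟩ : ℂ) +
        ∑ j : Fin k.val,
          (c ⟨j.val, by omega⟩ ⟨k.val - j.val - 1, by omega⟩ : ℂ) /
            (c ⟨j.val, by omega⟩ ⟨k.val - j.val, by omega⟩ : ℂ) := by
  obtain ⟨u, v, hu, hv, hminor⟩ :=
    TypeB.exists_genMinor_eq hk (w₀ * TypeB.simple k) 1 (TypeB.theta c)
  have hrows : Set.range (TypeB.rowIdx hk) = TypeB.vecPerm n u '' Set.range (TypeB.topIdx k) := by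
    rw [TypeB.range_rowIdx hk hw₀, TypeB.image_range_topIdx_congr hu]
  have hcols : Set.range (TypeB.topIdx k) = TypeB.vecPerm n v '' Set.range (TypeB.topIdx k) := by
    rw [TypeB.image_range_topIdx_congr hv, map_one, Equiv.Perm.coe_one, Set.image_id]
  calc TypeB.genMinor (TypeB.fundWeight k) ((w₀ * TypeB.simple k).1 (TypeB.fundWeight k))
        (TypeB.fundWeight k) (TypeB.theta c)
      = TypeB.leadingMinor k ((TypeB.lift u)⁻¹ * TypeB.theta c * TypeB.lift v).1.1 := hminor
    _ = ((TypeB.vecRep n (TypeB.theta c)).submatrix (TypeB.rowIdx hk) (TypeB.topIdx k)).det :=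
        TypeB.leadingMinor_lift (TypeB.strictAnti_height_rowIdx hk) hrows
          (TypeB.isSortedIsotropic_topIdx k).strictAnti hcols (TypeB.theta c)
    _ = _ := TypeB.det_submatrix_theta hk c
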